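/- Let $p_0:\mathbb R\to(0,\infty)$ be a differentiable, everywhere positive probability density such that, for some real constants $A,B$, $$|\partial_x\log p_0(x)|\le A+B|x|\qquad\text{for all }x\in\mathbb R .$$ Let $z\sim\mathcal N(0,1)$ be independent of $x_0\sim p_0$, and let $\alpha,\gamma:[0,1]\to\mathbb R$ be $C^1$ functions with $\alpha(0)=0$, $\alpha(1)=1$, $\gamma(0)=1$, $\gamma(1)=0$ and $\gamma(t)\ne0$ for $t\in(0,1)$. Put $x_t=\alpha(t)z+\gamma(t)x_0$ for $t\in[0,1]$. Then $x_0\sim p_0$, $x_1\sim\mathcal N(0,1)$, and every $x_t$ has a positive differentiable density $p_t$, namely $p_t(x)=\int_{\mathbb R}\frac{e^{-u^2/2}}{\sqrt{2\pi}}\,\frac{1}{|\gamma(t)|}\,p_0\!\left(\frac{x-\alpha(t)u}{\gamma(t)}\right)du$ for $t<1$, and the standard normal density for $t=1$. Let $F_t(x)=\int_{-\infty}^x p_t(u)\,du$, and for $t\in[0,1)$ let $$v(x,t)=\frac{\gamma'(t)}{\gamma(t)}\,x-\Bigl[\alpha(t)\alpha'(t)-\frac{\gamma'(t)}{\gamma(t)}\alpha(t)^2\Bigr]\partial_x\log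 p_t(x).$$ (1) For every $x_1\in\mathbb R$ there is a unique continuous function $t\mapsto x_t(x_1)$ on $[0,1]$ that has the value $x_1$ at $t=1$ and satisfies the backward ODE $\frac{d}{dt}x_t=v(x_t,t)$ for all $t\in[0,1)$ (with the one-sided derivative at $t=0$). It is $C^1$ on $[0,1)$. If moreover $\int|x|\,p_0(x)\,dx<\infty$, then it is $C^1$ on all of $[0,1]$, and its derivative at $t=1$ is $\alpha'(1)x_1+\gamma'(1)\int x\,p_0(x)\,dx$. (2) $F_0$ is a strictly increasing bijection of $\mathbb R$ onto $(0,1)$, $F_1$ takes values in $(0,1)$, and the map $g(x_1)=x_0(x_1)$ (the value of the solution at $t=0$) satisfies $g(x_1)=F_0^{-1}(F_1(x_1))$ for all $x_1\in\mathbb R$. (3) $g$ is strictly increasing and pushes $\mathcal N(0,1)$ forward to $p_0(x)\,dx$; and every nondecreasing $h:\mathbb R\to\mathbb R$ that pushes $\mathcal N(0,1)$ forward to $p_0(x)\,dx$ equals $g$ everywhere. -/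

import Mathlib

open MeasureTheory ProbabilityTheory Set

noncomputable section

namespace ProbabilityFlow

/-- An everywhere positive, differentiable probability density on `ℝ`
(so that its score `(log p)'` makes sense at every point). -/
structure IsPositiveDensity (p : ℝ → ℝ) : Prop where
  pos : ∀ x, 0 < p x
  differentiable : Differentiable ℝ p
  integral_eq_one : ∫ x, p x = 1

/-- The measure `p(x) dx` on `ℝ`. -/
def densityMeasure (p : ℝ → ℝ) : Measure ℝ :=
  volume.withDensity (fun x => ENNReal.ofReal (p x))

/-- The score `∂ₓ log p`. -/
def score (p : ℝ → ℝ) (x : ℝ) : ℝ :=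
  deriv (fun y => Real.log (p y)) x

/-- A `C¹` interpolation schedule on `[0,1]`. -/
structure IsSchedule (α γ : ℝ → ℝ) : Prop where
  contDiffOn_α : ContDiffOn ℝ 1 α (Icc 0 1)
  contDiffOn_γ : ContDiffOn ℝ 1 γ (Icc 0 1)
  α_zero : α 0 = 0
  α_one : α 1 = 1
  γ_zero : γ 0 = 1
  γ_one : γ 1 = 0
  γ_ne_zero : ∀ t ∈ Ioo (0 : ℝ) 1, γ t ≠ 0

/-- The derivative on `[0,1]` (one-sided at the endpoints). -/
def timeDeriv (f : ℝ → ℝ) (t : ℝ) : ℝ :=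
  derivWithin f (Icc 0 1) t

/-- The forward process `x_t = α(t) z + γ(t) x₀`. -/
def forwardProcess {Ω : Type*} (α γ : ℝ → ℝ) (z x₀ : Ω → ℝ) (t : ℝ) (ω : Ω) : ℝ :=
  α t * z ω + γ t * x₀ ω

/-- The density `p_t` of `α(t) z + γ(t) x₀`, where `z ∼ N(0,1)` and `x₀ ∼ p₀` are independent:
the Gaussian average over `z` of the density of `α(t) z + γ(t) x₀` for fixed `z`; if `γ(t) = 0`,
it is the density of `N(0, α(t)²)`. -/
def marginalDensity (p₀ α γ : ℝ → ℝ) (t x : ℝ) : ℝ :=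
  if γ t = 0 then gaussianPDFReal 0 ⟨α t ^ 2, sq_nonneg (α t)⟩ x
  else ∫ z, gaussianPDFReal 0 1 z * (|γ t|⁻¹ * p₀ ((x - α t * z) / γ t))

/-- The distribution function `F_t(x) = ∫_{-∞}^x p_t(u) du`. -/
def marginalCDF (p₀ α γ : ℝ → ℝ) (t x : ℝ) : ℝ :=
  ∫ u in Iic x, marginalDensity p₀ α γ t u

/-- The velocity field of the probability-flow ODE; it is meaningful where `γ(t) ≠ 0`. -/
def velocity (p₀ α γ : ℝ → ℝ) (x t : ℝ) : ℝ :=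
  timeDeriv γ t / γ t * x
    - (α t * timeDeriv α t - timeDeriv γ t / γ t * α t ^ 2)
      * score (marginalDensity p₀ α γ t) x

/-- `x` is a solution on `[0,1]` of the backward ODE `x' = v(x,t)` started from `x(1) = x₁`:
it is continuous on `[0,1]`, has the terminal value `x₁`, and satisfies the equation at every time
`t ∈ [0,1)`, i.e. wherever the velocity field is defined (the formula divides by `γ(1) = 0` at
`t = 1`). -/
structure IsBackwardSolution (p₀ α γ : ℝ → ℝ) (x₁ : ℝ) (x : ℝ → ℝ) : Prop where
  continuousOn : ContinuousOn x (Icc 0 1)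
  terminal : x 1 = x₁
  hasDerivWithinAt : ∀ t ∈ Ico (0 : ℝ) 1,
    HasDerivWithinAt x (velocity p₀ α γ (x t) t) (Icc 0 1) t

end ProbabilityFlow

end

namespace ProbabilityFlow

open Filter Topology

/-! ### Distribution functions of positive densities -/

/-! In one dimension the ODE preserves quantiles. Its velocity is the conditional mean `E[α' z + γ'
x₀ | x_t = x]`, because Gaussian integration by parts gives `E[z | x_t = x] = -α ∂ₓ log p_t`
(`velocity_mul_marginalDensity`). Hence `∂ₜ F_t = -v p_t`, while `∂ₓ F_t = p_t`, so `F_t(x_t)` has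
zero derivative along a solution. Conversely, a continuous curve on which `F_t` is constant solves
the ODE. Solutions are therefore exactly the curves `F_t⁻¹(F_1(x₁))`, which gives existence and
uniqueness at once, without any Lipschitz bound on `v`; at `t = 0` this is the monotone
rearrangement.

The linear score bound enters through the growth of `p₀` and `p₀'`, at most polynomial, which
justifies every limit and derivative under a Gaussian integral. At `t = 1`, where `v` is undefined,
continuity comes from the laws: `x_t` converges pointwise and the limit has no atoms
(`tendsto_marginalCDF`). With a finite first moment, exchanging the roles of `z` and `x₀` in the
integrals removes the division by `γ` and yields the limit of `v` (`tendsto_velocity_one`). -/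

lemma integral_Iic_add_intervalIntegral {p : ℝ → ℝ} (hp : Integrable p) (a x : ℝ) :
    (∫ u in Iic x, p u) = (∫ u in Iic a, p u) + ∫ u in a..x, p u := by
  have := intervalIntegral.integral_Iic_sub_Iic (μ := volume) (f := p) (a := a) (b := x)
    hp.integrableOn hp.integrableOn
  linarith

namespace IsPositiveDensity

variable {p : ℝ → ℝ}

lemma continuous (hp : IsPositiveDensity p) : Continuous p := hp.differentiable.continuous

lemma integrable (hp : IsPositiveDensity p) : Integrable p :=
  integrable_of_integral_eq_one hp.integral_eq_one

lemma hasDerivAt_cdf (hp : IsPositiveDensity p) (x : ℝ) :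
    HasDerivAt (fun y => ∫ u in Iic y, p u) (p x) x := by
  rw [funext (integral_Iic_add_intervalIntegral hp.integrable 0)]
  exact (hp.continuous.integral_hasStrictDerivAt 0 x).hasDerivAt.const_add _

lemma continuous_cdf (hp : IsPositiveDensity p) : Continuous (fun y => ∫ u in Iic y, p u) :=
  continuous_iff_continuousAt.2 fun x => (hp.hasDerivAt_cdf x).continuousAt

lemma strictMono_cdf (hp : IsPositiveDensity p) : StrictMono (fun y => ∫ u in Iic y, p u) :=
  strictMono_of_deriv_pos fun x => by rw [(hp.hasDerivAt_cdf x).deriv]; exact hp.pos x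

lemma isProbabilityMeasure (hp : IsPositiveDensity p) :
    IsProbabilityMeasure (densityMeasure p) := by
  refine ⟨?_⟩
  rw [densityMeasure, withDensity_apply _ .univ, setLIntegral_univ,
    ← ofReal_integral_eq_lintegral_ofReal hp.integrable (ae_of_all _ fun x => (hp.pos x).le),
    hp.integral_eq_one, ENNReal.ofReal_one]

lemma densityMeasure_apply (hp : IsPositiveDensity p) {s : Set ℝ} (hs : MeasurableSet s) :
    densityMeasure p s = ENNReal.ofReal (∫ u in s, p u) := by
  rw [densityMeasure, withDensity_apply _ hs,
    ofReal_integral_eq_lintegral_ofReal hp.integrable.integrableOn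
      (ae_of_all _ fun x => (hp.pos x).le)]

lemma densityMeasure_real_Iic (hp : IsPositiveDensity p) (x : ℝ) :
    (densityMeasure p).real (Iic x) = ∫ u in Iic x, p u := by
  rw [measureReal_def, hp.densityMeasure_apply measurableSet_Iic,
    ENNReal.toReal_ofReal (integral_nonneg fun x => (hp.pos x).le)]

lemma densityMeasure_singleton (p : ℝ → ℝ) (x : ℝ) : densityMeasure p {x} = 0 :=
  withDensity_absolutelyContinuous _ _ (measure_singleton x)

lemma tendsto_cdf_atBot (hp : IsPositiveDensity p) :
    Tendsto (fun y => ∫ u in Iic y, p u) atBot (𝓝 0) := by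
  have := hp.isProbabilityMeasure
  refine (ProbabilityTheory.tendsto_cdf_atBot (densityMeasure p)).congr fun x => ?_
  rw [cdf_eq_real, hp.densityMeasure_real_Iic]

lemma tendsto_cdf_atTop (hp : IsPositiveDensity p) :
    Tendsto (fun y => ∫ u in Iic y, p u) atTop (𝓝 1) := by
  have := hp.isProbabilityMeasure
  refine (ProbabilityTheory.tendsto_cdf_atTop (densityMeasure p)).congr fun x => ?_
  rw [cdf_eq_real, hp.densityMeasure_real_Iic]

lemma cdf_mem_Ioo (hp : IsPositiveDensity p) (x : ℝ) : (∫ u in Iic x, p u) ∈ Ioo (0 : ℝ) 1 :=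
  ⟨(hp.strictMono_cdf.monotone.le_of_tendsto hp.tendsto_cdf_atBot (x - 1)).trans_lt
      (hp.strictMono_cdf (sub_one_lt x)),
    (hp.strictMono_cdf (lt_add_one x)).trans_le
      (hp.strictMono_cdf.monotone.ge_of_tendsto hp.tendsto_cdf_atTop (x + 1))⟩

lemma exists_cdf_eq (hp : IsPositiveDensity p) {c : ℝ} (hc : c ∈ Ioo (0 : ℝ) 1) :
    ∃ x, (∫ u in Iic x, p u) = c :=
  mem_range_of_exists_le_of_exists_ge hp.continuous_cdf
    (hp.tendsto_cdf_atBot.eventually_le_const hc.1).exists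
    (hp.tendsto_cdf_atTop.eventually_const_le hc.2).exists

lemma bijOn_cdf (hp : IsPositiveDensity p) :
    BijOn (fun y => ∫ u in Iic y, p u) univ (Ioo 0 1) :=
  ⟨fun x _ => hp.cdf_mem_Ioo x, hp.strictMono_cdf.injective.injOn,
    fun _ hc => (hp.exists_cdf_eq hc).imp fun _ h => ⟨mem_univ _, h⟩⟩

lemma score_eq (hp : IsPositiveDensity p) (x : ℝ) : score p x = deriv p x / p x :=
  ((hp.differentiable x).hasDerivAt.log (hp.pos x).ne').deriv

/-! ### Polynomial growth from a linearly bounded score -/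

/-- On an interval of length `1 / (1 + |x|)` starting at `x` the score bound lets `log p` vary by at
most a constant. The mass there is then at least a constant times `p x / (1 + |x|)`, and it cannot
exceed one. -/
lemma exists_le_linear (hp : IsPositiveDensity p) {A B : ℝ}
    (hscore : ∀ x, |score p x| ≤ A + B * |x|) :
    ∃ C, 0 ≤ C ∧ ∀ x, p x ≤ C * (1 + |x|) := by
  set K := |A| + |B| with hK
  have hK0 : 0 ≤ K := by positivity
  have hb : ∀ x, |score p x| ≤ K * (1 + |x|) := fun x => by
    have h1 := hscore x
    have h2 := le_abs_self A
    have h3 := mul_le_mul_of_nonneg_right (le_abs_self B) (abs_nonneg x)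
    have h4 : 0 ≤ |A| * |x| := by positivity
    have h5 := abs_nonneg B
    rw [hK]; nlinarith
  refine ⟨Real.exp (2 * K), (Real.exp_pos _).le, fun x => ?_⟩
  set δ := (1 + |x|)⁻¹ with hδ
  have h1x : 0 < 1 + |x| := by positivity
  have hδ0 : 0 < δ := by positivity
  have hδ1 : δ ≤ 1 := inv_le_one_of_one_le₀ (by linarith [abs_nonneg x])
  have hδm : (1 + |x|) * δ = 1 := mul_inv_cancel₀ h1x.ne'
  have hd : ∀ y, HasDerivAt (fun y => Real.log (p y)) (score p y) y := fun y => by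
    rw [hp.score_eq]; exact (hp.differentiable y).hasDerivAt.log (hp.pos y).ne'
  have hlow : ∀ y ∈ Icc x (x + δ), p x * Real.exp (-(2 * K)) ≤ p y := fun y hy => by
    -- The factor 2 absorbs `1 + |u| ≤ 2 + |x| ≤ 2 (1 + |x|)` for `u` within distance one of `x`.
    have hyx : ‖Real.log (p y) - Real.log (p x)‖ ≤ (2 * K * (1 + |x|)) * ‖y - x‖ := by
      refine (convex_Icc x (x + δ)).norm_image_sub_le_of_norm_hasDerivWithin_le
        (fun u _ => (hd u).hasDerivWithinAt) (fun u hu => ?_) ⟨le_rfl, by linarith⟩ hy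
      refine (hb u).trans ?_
      have : |u| ≤ |x| + 1 := by
        have := abs_sub_abs_le_abs_sub u x
        rw [abs_of_nonneg (sub_nonneg.2 hu.1)] at this
        linarith [hu.2]
      have := abs_nonneg x
      nlinarith
    have hle : (2 * K * (1 + |x|)) * ‖y - x‖ ≤ 2 * K := by
      rw [Real.norm_of_nonneg (sub_nonneg.2 hy.1)]
      calc (2 * K * (1 + |x|)) * (y - x) ≤ (2 * K * (1 + |x|)) * δ := by
            gcongr; linarith [hy.2]
        _ = 2 * K := by rw [mul_assoc, hδm, mul_one]
    have h := neg_le_of_abs_le (hyx.trans hle)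
    calc p x * Real.exp (-(2 * K)) = Real.exp (Real.log (p x) + -(2 * K)) := by
          rw [Real.exp_add, Real.exp_log (hp.pos x)]
      _ ≤ Real.exp (Real.log (p y)) := Real.exp_le_exp.2 (by linarith)
      _ = p y := Real.exp_log (hp.pos y)
  have hpint : δ * (p x * Real.exp (-(2 * K))) ≤ 1 := by
    calc δ * (p x * Real.exp (-(2 * K)))
        = ∫ _ in Icc x (x + δ), p x * Real.exp (-(2 * K)) := by
          simp [measureReal_def, hδ0.le]
      _ ≤ ∫ y in Icc x (x + δ), p y :=
          setIntegral_mono_on (integrableOn_const (by simp)) hp.integrable.integrableOn measurableSet_Icc hlow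
      _ ≤ ∫ y, p y := setIntegral_le_integral hp.integrable (ae_of_all _ fun y => (hp.pos y).le)
      _ = 1 := hp.integral_eq_one
  have hE : Real.exp (-(2 * K)) * Real.exp (2 * K) = 1 := by rw [← Real.exp_add]; simp
  calc p x = (δ * (p x * Real.exp (-(2 * K)))) * (Real.exp (2 * K) * (1 + |x|)) := by
        linear_combination (-p x * ((1 + |x|) * δ)) * hE - p x * hδm
    _ ≤ 1 * (Real.exp (2 * K) * (1 + |x|)) := by gcongr
    _ = _ := one_mul _

lemma exists_abs_deriv_le (hp : IsPositiveDensity p) {A B : ℝ}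
    (hscore : ∀ x, |score p x| ≤ A + B * |x|) :
    ∃ C, 0 ≤ C ∧ ∀ x, |deriv p x| ≤ C * (1 + |x|) ^ 2 := by
  obtain ⟨C, hC0, hC⟩ := hp.exists_le_linear hscore
  refine ⟨(|A| + |B|) * C, by positivity, fun x => ?_⟩
  have h : deriv p x = score p x * p x := by
    rw [hp.score_eq, div_mul_cancel₀ _ (hp.pos x).ne']
  rw [h, abs_mul, abs_of_pos (hp.pos x)]
  calc |score p x| * p x ≤ ((|A| + |B|) * (1 + |x|)) * (C * (1 + |x|)) := by
        refine mul_le_mul ((hscore x).trans ?_) (hC x) (hp.pos x).le (by positivity)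
        have h2 := le_abs_self A
        have h3 := mul_le_mul_of_nonneg_right (le_abs_self B) (abs_nonneg x)
        have h4 : 0 ≤ |A| * |x| := by positivity
        have h5 := abs_nonneg B
        nlinarith
    _ = _ := by ring

end IsPositiveDensity

/-! ### Gaussian averages of functions of polynomial growth -/

lemma integrable_one_add_abs_pow_gaussianReal (k : ℕ) :
    Integrable (fun z : ℝ => (1 + |z|) ^ k) (gaussianReal 0 1) := by
  have h : MemLp (fun z : ℝ => 1 + |z|) (k : ENNReal) (gaussianReal 0 1) :=
    MemLp.add (f := fun _ : ℝ => (1 : ℝ)) (g := fun z => |z|) (memLp_const 1)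
      (memLp_id_gaussianReal' k (ENNReal.natCast_ne_top k)).norm
  refine h.integrable_norm_pow'.congr (ae_of_all _ fun z => ?_)
  simp only [Real.norm_eq_abs]
  rw [abs_of_nonneg (by positivity)]

/-- Bounding `c⁻¹` keeps `c` away from zero, so a single dominating function serves all nearby
parameters in the limits and derivatives below. -/
lemma one_add_abs_div_le {R x a c : ℝ} (hx : |x| ≤ R) (ha : |a| ≤ R) (hc : |c⁻¹| ≤ R) (z : ℝ) :
    1 + |(x - a * z) / c| ≤ (1 + R ^ 2) * (1 + |z|) := by
  have hR : 0 ≤ R := (abs_nonneg x).trans hx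
  have hz := abs_nonneg z
  have h1 : |x - a * z| ≤ R * (1 + |z|) := by
    calc |x - a * z| ≤ |x| + |a| * |z| := by rw [← abs_mul]; exact abs_sub _ _
      _ ≤ R + R * |z| := by gcongr
      _ = _ := by ring
  have h2 : |(x - a * z) / c| ≤ R * (1 + |z|) * R := by
    rw [div_eq_mul_inv, abs_mul]; gcongr
  nlinarith

lemma abs_pow_mul_comp_le {f : ℝ → ℝ} {C : ℝ} {k : ℕ} (hC : 0 ≤ C)
    (hf : ∀ w, |f w| ≤ C * (1 + |w|) ^ k) (i : ℕ) {R x a c : ℝ}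
    (hx : |x| ≤ R) (ha : |a| ≤ R) (hc : |c⁻¹| ≤ R) (z : ℝ) :
    |z ^ i * f ((x - a * z) / c)| ≤ C * (1 + R ^ 2) ^ k * (1 + |z|) ^ (i + k) := by
  have hz := abs_nonneg z
  calc |z ^ i * f ((x - a * z) / c)| = |z| ^ i * |f ((x - a * z) / c)| := by
        rw [abs_mul, abs_pow]
    _ ≤ (1 + |z|) ^ i * (C * ((1 + R ^ 2) * (1 + |z|)) ^ k) := by
        gcongr
        · linarith
        · refine (hf _).trans ?_
          gcongr
          exact one_add_abs_div_le hx ha hc z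
    _ = _ := by rw [mul_pow, pow_add]; ring

lemma integrable_pow_mul_comp {f : ℝ → ℝ} (hfm : Measurable f) {C : ℝ} {k : ℕ} (hC : 0 ≤ C)
    (hf : ∀ w, |f w| ≤ C * (1 + |w|) ^ k) (i : ℕ) (x a c : ℝ) :
    Integrable (fun z => z ^ i * f ((x - a * z) / c)) (gaussianReal 0 1) := by
  set R := max |x| (max |a| |c⁻¹|)
  refine ((integrable_one_add_abs_pow_gaussianReal (i + k)).const_mul
    (C * (1 + R ^ 2) ^ k)).mono' (by fun_prop) (ae_of_all _ fun z => ?_)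
  exact abs_pow_mul_comp_le hC hf i (le_max_left _ _)
    ((le_max_left _ _).trans (le_max_right _ _)) ((le_max_right _ _).trans (le_max_right _ _)) z

lemma integrable_comp_affine {f : ℝ → ℝ} (hfm : Measurable f) {C : ℝ} {k : ℕ} (hC : 0 ≤ C)
    (hf : ∀ w, |f w| ≤ C * (1 + |w|) ^ k) (x a c : ℝ) :
    Integrable (fun z => f ((x - a * z) / c)) (gaussianReal 0 1) := by
  simpa using integrable_pow_mul_comp hfm hC hf 0 x a c

/-- Joint continuity of `∫ zⁱ f((x - a z) / c) dN(z)` in `(x, a, c)` off `c = 0`. -/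
lemma continuousAt_integral_pow_mul_comp {f : ℝ → ℝ} (hfc : Continuous f) {C : ℝ} {k : ℕ}
    (hC : 0 ≤ C) (hf : ∀ w, |f w| ≤ C * (1 + |w|) ^ k) (i : ℕ) (x a : ℝ) {c : ℝ} (hc : c ≠ 0) :
    ContinuousAt (fun q : ℝ × ℝ × ℝ =>
      ∫ z, z ^ i * f ((q.1 - q.2.1 * z) / q.2.2) ∂(gaussianReal 0 1)) (x, a, c) := by
  set R := max |x| (max |a| |c⁻¹|) + 1 with hR
  have hxR : |x| < R := (le_max_left _ _).trans_lt (lt_add_one _)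
  have haR : |a| < R := ((le_max_left _ _).trans (le_max_right _ _)).trans_lt (lt_add_one _)
  have hcR : |c⁻¹| < R := ((le_max_right _ _).trans (le_max_right _ _)).trans_lt (lt_add_one _)
  have e1 : ∀ᶠ q : ℝ × ℝ × ℝ in 𝓝 (x, a, c), |q.1| < R :=
    (by fun_prop : ContinuousAt (fun q : ℝ × ℝ × ℝ => |q.1|) (x, a, c)).eventually_lt_const hxR
  have e2 : ∀ᶠ q : ℝ × ℝ × ℝ in 𝓝 (x, a, c), |q.2.1| < R :=
    (by fun_prop : ContinuousAt (fun q : ℝ × ℝ × ℝ => |q.2.1|) (x, a, c)).eventually_lt_const haR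
  have e3 : ∀ᶠ q : ℝ × ℝ × ℝ in 𝓝 (x, a, c), |q.2.2⁻¹| < R := by
    have : ContinuousAt (fun q : ℝ × ℝ × ℝ => |q.2.2⁻¹|) (x, a, c) :=
      (ContinuousAt.inv₀ (by fun_prop) hc).abs
    exact this.eventually_lt_const hcR
  refine continuousAt_of_dominated (bound := fun z => C * (1 + R ^ 2) ^ k * (1 + |z|) ^ (i + k))
    (.of_forall fun q => ?_) ?_
    ((integrable_one_add_abs_pow_gaussianReal (i + k)).const_mul _) (ae_of_all _ fun z => ?_)
  · have := hfc.measurable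
    fun_prop
  · filter_upwards [e1, e2, e3] with q h1 h2 h3
    exact ae_of_all _ fun z => abs_pow_mul_comp_le hC hf i h1.le h2.le h3.le z
  · refine continuousAt_const.mul (ContinuousAt.comp' (g := f) hfc.continuousAt ?_)
    exact ContinuousAt.div (by fun_prop) (by fun_prop) hc

lemma hasDerivAt_integral_comp_affine {f : ℝ → ℝ} (hfd : Differentiable ℝ f) {C C' : ℝ} {k k' : ℕ}
    (hC : 0 ≤ C) (hf : ∀ w, |f w| ≤ C * (1 + |w|) ^ k)
    (hC' : 0 ≤ C') (hf' : ∀ w, |deriv f w| ≤ C' * (1 + |w|) ^ k') (x a c : ℝ) :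
    HasDerivAt (fun x => ∫ z, f ((x - a * z) / c) ∂(gaussianReal 0 1))
      ((∫ z, deriv f ((x - a * z) / c) ∂(gaussianReal 0 1)) / c) x := by
  -- The bound must hold for every `y` in the unit ball around `x`, hence `|x| + 1`.
  set R := max (|x| + 1) (max |a| |c⁻¹|)
  have hmd := measurable_deriv f
  have hm := hfd.continuous.measurable
  rw [← integral_div]
  refine (hasDerivAt_integral_of_dominated_loc_of_deriv_le
    (F := fun x z => f ((x - a * z) / c)) (F' := fun x z => deriv f ((x - a * z) / c) / c)
    (s := Metric.ball x 1)
    (bound := fun z => C' * (1 + R ^ 2) ^ k' * (1 + |z|) ^ (0 + k') / |c|)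
    (Metric.ball_mem_nhds x one_pos)
    (.of_forall fun y => (hm.comp (by fun_prop)).aestronglyMeasurable)
    (integrable_comp_affine hm hC hf x a c)
    ((hmd.comp (by fun_prop)).div_const c).aestronglyMeasurable (ae_of_all _ fun z y hy => ?_)
    (((integrable_one_add_abs_pow_gaussianReal (0 + k')).const_mul _).div_const _)
    (ae_of_all _ fun z y _ => ?_)).2
  · have hy' : |y| ≤ |x| + 1 := by
      have := abs_sub_abs_le_abs_sub y x
      rw [Metric.mem_ball, Real.dist_eq] at hy
      linarith
    have := abs_pow_mul_comp_le hC' hf' 0 (hy'.trans (le_max_left _ _) : |y| ≤ R)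
      ((le_max_left _ _).trans (le_max_right _ _) : |a| ≤ R)
      ((le_max_right _ _).trans (le_max_right _ _) : |c⁻¹| ≤ R) z
    rw [pow_zero, one_mul] at this
    rw [Real.norm_eq_abs, abs_div]
    gcongr
  · have h1 : HasDerivAt (fun y => (y - a * z) / c) (1 / c) y :=
      ((hasDerivAt_id y).sub_const _).div_const c
    have := (hfd ((y - a * z) / c)).hasDerivAt.comp y h1
    rwa [mul_one_div] at this

lemma hasDerivAt_gaussianPDFReal_zero_one (z : ℝ) :
    HasDerivAt (gaussianPDFReal 0 1) (-z * gaussianPDFReal 0 1 z) z := by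
  have h : HasDerivAt (fun x : ℝ => -(x - 0) ^ 2 / (2 * ((1 : NNReal) : ℝ))) (-z) z := by
    have := ((((hasDerivAt_id z).sub_const 0).pow 2).neg).div_const (2 * ((1 : NNReal) : ℝ))
    refine this.congr_deriv ?_
    simp only [id_eq, NNReal.coe_one]
    ring
  rw [gaussianPDFReal_def]
  refine (h.exp.const_mul _).congr_deriv ?_
  ring

lemma integrable_gaussianReal_iff {f : ℝ → ℝ} :
    Integrable f (gaussianReal 0 1) ↔ Integrable (fun z => gaussianPDFReal 0 1 z * f z) := by
  rw [gaussianReal_of_var_ne_zero 0 one_ne_zero]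
  rw [integrable_withDensity_iff_integrable_smul' (measurable_gaussianPDF 0 1)
    (ae_of_all _ fun _ => gaussianPDF_lt_top)]
  simp [toReal_gaussianPDF]

lemma integral_gaussianReal_eq {f : ℝ → ℝ} :
    ∫ z, f z ∂(gaussianReal 0 1) = ∫ z, gaussianPDFReal 0 1 z * f z := by
  simpa using integral_gaussianReal_eq_integral_smul (f := f) (μ := 0) (one_ne_zero : (1 : NNReal) ≠ 0)

/-- Gaussian integration by parts along an affine map. -/
lemma integral_mul_comp_affine {f : ℝ → ℝ} (hfd : Differentiable ℝ f) {C C' : ℝ} {k k' : ℕ}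
    (hC : 0 ≤ C) (hf : ∀ w, |f w| ≤ C * (1 + |w|) ^ k)
    (hC' : 0 ≤ C') (hf' : ∀ w, |deriv f w| ≤ C' * (1 + |w|) ^ k') (x a c : ℝ) :
    ∫ z, z * f ((x - a * z) / c) ∂(gaussianReal 0 1)
      = -(a / c) * ∫ z, deriv f ((x - a * z) / c) ∂(gaussianReal 0 1) := by
  have hd : ∀ z, HasDerivAt (fun z => f ((x - a * z) / c))
      (-(a / c) * deriv f ((x - a * z) / c)) z := fun z => by
    have h1 : HasDerivAt (fun z => (x - a * z) / c) (-(a / c)) z := by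
      refine ((((hasDerivAt_id z).const_mul a).const_sub x).div_const c).congr_deriv ?_
      ring
    have := (hfd ((x - a * z) / c)).hasDerivAt.comp z h1
    rwa [mul_comm] at this
  have i0 := integrable_comp_affine hfd.continuous.measurable hC hf x a c
  have i1 := integrable_pow_mul_comp hfd.continuous.measurable hC hf 1 x a c
  have i2 := (integrable_comp_affine (measurable_deriv f) hC' hf' x a c).const_mul (-(a / c))
  rw [integrable_gaussianReal_iff] at i0 i1 i2
  -- The identity `φ' = -z φ` trades the weight `z` for a derivative; integrability of the product
  -- and of both halves of its derivative disposes of the boundary terms.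
  have key := integral_mul_deriv_eq_deriv_mul_of_integrable
    (fun z _ => hasDerivAt_gaussianPDFReal_zero_one z) (fun z _ => hd z) i2
    (i1.neg.congr (ae_of_all _ fun z => by simp; ring)) i0
  rw [← integral_const_mul, integral_gaussianReal_eq, integral_gaussianReal_eq, key,
    ← integral_neg]
  congr 1 with z
  ring

/-- Meant for `f` the distribution function of `p₀`: the argument `w = (x - α z) / γ` moves with
speed `-(α' z + γ' w) / γ`, so the derivative is minus the flux. -/
lemma hasDerivAt_integral_comp_path {f f' : ℝ → ℝ} (hfd : ∀ w, HasDerivAt f (f' w) w)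
    (hf'm : Measurable f') {C C' : ℝ} {k k' : ℕ}
    (hC : 0 ≤ C) (hf : ∀ w, |f w| ≤ C * (1 + |w|) ^ k)
    (hC' : 0 ≤ C') (hf' : ∀ w, |f' w| ≤ C' * (1 + |w|) ^ k') (x : ℝ)
    {α γ α' γ' : ℝ → ℝ} {t : ℝ} {s : Set ℝ} (hs : s ∈ 𝓝 t)
    (hα : ∀ u ∈ s, HasDerivAt α (α' u) u) (hγ : ∀ u ∈ s, HasDerivAt γ (γ' u) u)
    (hγ0 : ∀ u ∈ s, γ u ≠ 0) {R : ℝ} (hx : |x| ≤ R) (hαR : ∀ u ∈ s, |α u| ≤ R)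
    (hγR : ∀ u ∈ s, |(γ u)⁻¹| ≤ R) (hα'R : ∀ u ∈ s, |α' u| ≤ R) (hγ'R : ∀ u ∈ s, |γ' u| ≤ R) :
    HasDerivAt (fun u => ∫ z, f ((x - α u * z) / γ u) ∂(gaussianReal 0 1))
      (-(∫ z, (γ t)⁻¹ * (f' ((x - α t * z) / γ t)
        * (α' t * z + γ' t * ((x - α t * z) / γ t))) ∂(gaussianReal 0 1))) t := by
  have hR : 0 ≤ R := (abs_nonneg x).trans hx
  have hm : Measurable f := (continuous_iff_continuousAt.2 fun w => (hfd w).continuousAt).measurable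
  rw [← integral_neg]
  refine (hasDerivAt_integral_of_dominated_loc_of_deriv_le
    (F := fun u z => f ((x - α u * z) / γ u))
    (F' := fun u z => -((γ u)⁻¹ * (f' ((x - α u * z) / γ u)
        * (α' u * z + γ' u * ((x - α u * z) / γ u)))))
    (s := s)
    -- The factors bound, in order, `1 / γ`, `f'`, and `α' z + γ' w`; the last one costs the extra
    -- power of `1 + |z|`.
    (bound := fun z => R * (C' * (1 + R ^ 2) ^ k' * (R + R * (1 + R ^ 2))) * (1 + |z|) ^ (k' + 1)) hs
    (.of_forall fun y => (hm.comp (by fun_prop)).aestronglyMeasurable)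
    (integrable_comp_affine hm hC hf x _ _)
    (by fun_prop) (ae_of_all _ fun z u hu => ?_)
    ((integrable_one_add_abs_pow_gaussianReal (k' + 1)).const_mul _)
    (ae_of_all _ fun z u hu => ?_)).2
  · have hz := abs_nonneg z
    have b1 := abs_pow_mul_comp_le hC' hf' 0 hx (hαR u hu) (hγR u hu) z
    rw [pow_zero, one_mul, zero_add] at b1
    have b2 := one_add_abs_div_le hx (hαR u hu) (hγR u hu) z
    have b3 : |α' u * z + γ' u * ((x - α u * z) / γ u)|
        ≤ R * (1 + |z|) + R * ((1 + R ^ 2) * (1 + |z|)) := by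
      refine (abs_add_le _ _).trans ?_
      rw [abs_mul, abs_mul]
      gcongr
      · exact hα'R u hu
      · linarith
      · exact hγ'R u hu
      · linarith
    rw [norm_neg, Real.norm_eq_abs, abs_mul, abs_mul]
    calc |(γ u)⁻¹| * (|f' ((x - α u * z) / γ u)| * |α' u * z + γ' u * ((x - α u * z) / γ u)|)
        ≤ R * ((C' * (1 + R ^ 2) ^ k' * (1 + |z|) ^ k')
          * (R * (1 + |z|) + R * ((1 + R ^ 2) * (1 + |z|)))) := by
          gcongr
          exact hγR u hu
      _ = _ := by ring
  · have h1 : HasDerivAt (fun u => (x - α u * z) / γ u)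
        (-((γ u)⁻¹ * (α' u * z + γ' u * ((x - α u * z) / γ u)))) u := by
      refine ((((hα u hu).mul_const z).const_sub x).div (hγ u hu) (hγ0 u hu)).congr_deriv ?_
      have := hγ0 u hu
      field_simp
      ring
    refine ((hfd ((x - α u * z) / γ u)).comp u h1).congr_deriv ?_
    ring

/-! ### The marginal densities and their laws -/

/-- A positive differentiable derivative of the distribution function is a density. -/
lemma isPositiveDensity_of_hasDerivAt_cdf (μ : Measure ℝ) [IsProbabilityMeasure μ] {m : ℝ → ℝ}
    (hpos : ∀ x, 0 < m x) (hdiff : Differentiable ℝ m)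
    (hderiv : ∀ x, HasDerivAt (fun y => μ.real (Iic y)) (m x) x) :
    IsPositiveDensity m ∧ densityMeasure m = μ := by
  have hbot : Tendsto (fun y => μ.real (Iic y)) atBot (𝓝 0) :=
    (tendsto_cdf_atBot μ).congr fun x => cdf_eq_real μ x
  have htop : Tendsto (fun y => μ.real (Iic y)) atTop (𝓝 1) :=
    (tendsto_cdf_atTop μ).congr fun x => cdf_eq_real μ x
  have hpint : Integrable m := by
    -- Integrals of `m` over bounded intervals are differences of values of the distribution
    -- function, hence at most one.
    refine integrable_of_intervalIntegral_norm_bounded (l := atTop) (a := fun n : ℕ => -(n : ℝ))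
      (b := fun n : ℕ => (n : ℝ)) 1 (fun n => ?_)
      (tendsto_neg_atTop_atBot.comp tendsto_natCast_atTop_atTop) tendsto_natCast_atTop_atTop
      (.of_forall fun n => ?_)
    · exact hdiff.continuous.integrableOn_Ioc
    · simp_rw [Real.norm_of_nonneg (hpos _).le]
      rw [intervalIntegral.integral_eq_sub_of_hasDerivAt (fun x _ => hderiv x)
        (hdiff.continuous.intervalIntegrable _ _)]
      linarith [measureReal_le_one (μ := μ) (s := Iic (n : ℝ)),
        measureReal_nonneg (μ := μ) (s := Iic (-(n : ℝ)))]
  have h : IsPositiveDensity m := ⟨hpos, hdiff, by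
    rw [integral_of_hasDerivAt_of_tendsto hderiv hpint hbot htop, sub_zero]⟩
  have := h.isProbabilityMeasure
  refine ⟨h, Measure.ext_of_Iic _ _ fun x => ?_⟩
  rw [h.densityMeasure_apply measurableSet_Iic,
    integral_Iic_of_hasDerivAt_of_tendsto' (fun x _ => hderiv x) hpint.integrableOn hbot, sub_zero,
    ofReal_measureReal]

lemma isPositiveDensity_gaussianPDFReal : IsPositiveDensity (gaussianPDFReal 0 1) :=
  ⟨fun x => gaussianPDFReal_pos 0 1 x one_ne_zero,
    fun x => (hasDerivAt_gaussianPDFReal_zero_one x).differentiableAt,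
    integral_gaussianPDFReal_eq_one 0 one_ne_zero⟩

lemma densityMeasure_gaussianPDFReal :
    densityMeasure (gaussianPDFReal 0 1) = gaussianReal 0 1 := by
  rw [gaussianReal_of_var_ne_zero 0 one_ne_zero]
  rfl

namespace IsSchedule

variable {α γ : ℝ → ℝ}

/-- Starting from `γ 0 = 1`, a change of sign would force a zero before time one. -/
lemma γ_pos (h : IsSchedule α γ) {t : ℝ} (ht : t ∈ Ico (0 : ℝ) 1) : 0 < γ t := by
  have hne : ∀ s ∈ Icc 0 t, γ s ≠ 0 := fun s hs => by
    rcases hs.1.eq_or_lt with rfl | h0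
    · rw [h.γ_zero]; exact one_ne_zero
    · exact h.γ_ne_zero s ⟨h0, hs.2.trans_lt ht.2⟩
  by_contra hneg
  have hc : ContinuousOn γ (Icc 0 t) :=
    h.contDiffOn_γ.continuousOn.mono (Icc_subset_Icc_right ht.2.le)
  obtain ⟨s, hs, hs0⟩ := intermediate_value_Icc' ht.1 hc
    (⟨not_lt.1 hneg, by rw [h.γ_zero]; exact zero_le_one⟩ : (0 : ℝ) ∈ Icc (γ t) (γ 0))
  exact hne s hs hs0

end IsSchedule

variable {p₀ α γ : ℝ → ℝ}

lemma marginalDensity_eq {t : ℝ} (ht : 0 < γ t) (x : ℝ) :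
    marginalDensity p₀ α γ t x
      = (γ t)⁻¹ * ∫ z, p₀ ((x - α t * z) / γ t) ∂(gaussianReal 0 1) := by
  rw [marginalDensity, if_neg ht.ne', integral_gaussianReal_eq, abs_of_pos ht,
    ← integral_const_mul]
  congr 1 with z
  ring

lemma marginalDensity_one (h : IsSchedule α γ) :
    marginalDensity p₀ α γ 1 = gaussianPDFReal 0 1 := by
  have h1 : (⟨α 1 ^ 2, sq_nonneg (α 1)⟩ : NNReal) = 1 := by
    ext; simp [h.α_one]
  ext x
  rw [marginalDensity, if_pos h.γ_one, h1]
  rfl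

section

variable (hp : IsPositiveDensity p₀) {A B : ℝ} (hscore : ∀ x, |score p₀ x| ≤ A + B * |x|)
include hp

lemma abs_cdf_le (w : ℝ) : |∫ u in Iic w, p₀ u| ≤ 1 * (1 + |w|) ^ 0 := by
  have := hp.cdf_mem_Ioo w
  rw [abs_of_pos this.1]
  simpa using this.2.le

include hscore

lemma exists_abs_le_linear : ∃ C, 0 ≤ C ∧ ∀ w, |p₀ w| ≤ C * (1 + |w|) ^ 1 := by
  simpa only [pow_one, abs_of_pos (hp.pos _)] using hp.exists_le_linear hscore

lemma integrable_density_comp_affine (x a c : ℝ) :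
    Integrable (fun z => p₀ ((x - a * z) / c)) (gaussianReal 0 1) := by
  obtain ⟨C, hC0, hC⟩ := exists_abs_le_linear hp hscore
  exact integrable_comp_affine hp.continuous.measurable hC0 hC x a c

lemma marginalDensity_pos {t : ℝ} (ht : 0 < γ t) (x : ℝ) : 0 < marginalDensity p₀ α γ t x := by
  rw [marginalDensity_eq ht]
  refine mul_pos (inv_pos.2 ht) ?_
  rw [integral_pos_iff_support_of_nonneg (fun z => (hp.pos _).le)
    (integrable_density_comp_affine hp hscore x _ _)]
  have : (Function.support fun z => p₀ ((x - α t * z) / γ t)) = univ := by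
    ext z; simp [(hp.pos _).ne']
  simp [this]

lemma hasDerivAt_marginalDensity {t : ℝ} (ht : 0 < γ t) (x : ℝ) :
    HasDerivAt (marginalDensity p₀ α γ t)
      ((γ t)⁻¹ * ((∫ z, deriv p₀ ((x - α t * z) / γ t) ∂(gaussianReal 0 1)) / γ t)) x := by
  obtain ⟨C, hC0, hC⟩ := exists_abs_le_linear hp hscore
  obtain ⟨C', hC0', hC'⟩ := hp.exists_abs_deriv_le hscore
  rw [funext (marginalDensity_eq (p₀ := p₀) (α := α) ht)]
  exact (hasDerivAt_integral_comp_affine hp.differentiable hC0 hC hC0' hC' x _ _).const_mul _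

lemma hasDerivAt_integral_cdf_comp {t : ℝ} (ht : 0 < γ t) (x : ℝ) :
    HasDerivAt (fun x => ∫ z, (∫ u in Iic ((x - α t * z) / γ t), p₀ u) ∂(gaussianReal 0 1))
      (marginalDensity p₀ α γ t x) x := by
  obtain ⟨C, hC0, hC⟩ := exists_abs_le_linear hp hscore
  have hd : deriv (fun w => ∫ u in Iic w, p₀ u) = p₀ := funext fun w => (hp.hasDerivAt_cdf w).deriv
  have := hasDerivAt_integral_comp_affine (f := fun w => ∫ u in Iic w, p₀ u)
    (fun w => (hp.hasDerivAt_cdf w).differentiableAt) zero_le_one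
    (abs_cdf_le hp) hC0 (by rwa [hd]) x (α t) (γ t)
  rw [hd] at this
  refine this.congr_deriv ?_
  rw [marginalDensity_eq ht, div_eq_inv_mul]

omit hscore in
-- Fubini: for fixed `z`, the event `a z + c y ≤ x` is the half-line `y ≤ (x - a z) / c`.
lemma map_prod_real_Iic (a : ℝ) {c : ℝ} (hc : 0 < c) (x : ℝ) :
    (((gaussianReal 0 1).prod (densityMeasure p₀)).map (fun q => a * q.1 + c * q.2)).real (Iic x)
      = ∫ z, (∫ u in Iic ((x - a * z) / c), p₀ u) ∂(gaussianReal 0 1) := by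
  have := hp.isProbabilityMeasure
  have hm : Measurable (fun q : ℝ × ℝ => a * q.1 + c * q.2) := by fun_prop
  rw [map_measureReal_apply hm measurableSet_Iic, measureReal_def,
    Measure.prod_apply (hm measurableSet_Iic), ← integral_toReal]
  · congr 1 with z
    rw [← hp.densityMeasure_real_Iic, measureReal_def]
    congr 2
    ext y
    simp only [mem_preimage, mem_Iic, le_div_iff₀ hc]
    constructor <;> intro h <;> linarith
  · exact (measurable_measure_prodMk_left (hm measurableSet_Iic)).aemeasurable
  · exact ae_of_all _ fun z => measure_lt_top _ _

lemma isPositiveDensity_marginalDensity_and_law {t : ℝ} (ht : 0 < γ t) :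
    IsPositiveDensity (marginalDensity p₀ α γ t) ∧
      densityMeasure (marginalDensity p₀ α γ t)
        = ((gaussianReal 0 1).prod (densityMeasure p₀)).map (fun q => α t * q.1 + γ t * q.2) := by
  have := hp.isProbabilityMeasure
  have : IsProbabilityMeasure (((gaussianReal 0 1).prod (densityMeasure p₀)).map
      (fun q => α t * q.1 + γ t * q.2)) :=
    Measure.isProbabilityMeasure_map (by fun_prop)
  refine isPositiveDensity_of_hasDerivAt_cdf _ (marginalDensity_pos hp hscore ht)
    (fun x => (hasDerivAt_marginalDensity hp hscore ht x).differentiableAt) fun x => ?_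
  simp_rw [map_prod_real_Iic hp (α t) ht]
  exact hasDerivAt_integral_cdf_comp hp hscore ht x

lemma isPositiveDensity_marginalDensity (h : IsSchedule α γ) {t : ℝ} (ht : t ∈ Icc (0 : ℝ) 1) :
    IsPositiveDensity (marginalDensity p₀ α γ t) := by
  rcases ht.2.eq_or_lt with rfl | h1
  · rw [marginalDensity_one h]; exact isPositiveDensity_gaussianPDFReal
  · exact (isPositiveDensity_marginalDensity_and_law hp hscore (h.γ_pos ⟨ht.1, h1⟩)).1

lemma marginalCDF_eq {t : ℝ} (ht : 0 < γ t) (x : ℝ) :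
    marginalCDF p₀ α γ t x
      = ∫ z, (∫ u in Iic ((x - α t * z) / γ t), p₀ u) ∂(gaussianReal 0 1) := by
  obtain ⟨h1, h2⟩ := isPositiveDensity_marginalDensity_and_law (α := α) hp hscore ht
  rw [marginalCDF, ← h1.densityMeasure_real_Iic, h2, map_prod_real_Iic hp (α t) ht]

/-! ### Laws of the forward process and joint continuity of `F_t(x)` -/

variable {Ω : Type*} [MeasurableSpace Ω] {P : Measure Ω} [IsProbabilityMeasure P] {z x₀ : Ω → ℝ}
  (hz : HasLaw z (gaussianReal 0 1) P) (hx₀ : HasLaw x₀ (densityMeasure p₀) P)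
  (hindep : IndepFun z x₀ P)

omit hp hscore [IsProbabilityMeasure P] in
include hz in
lemma hasLaw_forwardProcess_one (h : IsSchedule α γ) :
    HasLaw (forwardProcess α γ z x₀ 1) (gaussianReal 0 1) P := by
  have : forwardProcess α γ z x₀ 1 = z := by
    ext ω; simp [forwardProcess, h.α_one, h.γ_one]
  rwa [this]

omit hp hscore [IsProbabilityMeasure P] in
include hx₀ in
lemma hasLaw_forwardProcess_zero (h : IsSchedule α γ) :
    HasLaw (forwardProcess α γ z x₀ 0) (densityMeasure p₀) P := by
  have : forwardProcess α γ z x₀ 0 = x₀ := by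
    ext ω; simp [forwardProcess, h.α_zero, h.γ_zero]
  rwa [this]

include hz hx₀ hindep

lemma hasLaw_forwardProcess (h : IsSchedule α γ) {t : ℝ} (ht : t ∈ Icc (0 : ℝ) 1) :
    HasLaw (forwardProcess α γ z x₀ t) (densityMeasure (marginalDensity p₀ α γ t)) P := by
  rcases ht.2.eq_or_lt with rfl | h1
  · rw [marginalDensity_one h, densityMeasure_gaussianPDFReal]
    exact hasLaw_forwardProcess_one hz h
  · have h2 := (isPositiveDensity_marginalDensity_and_law (α := α) hp hscore
      (h.γ_pos ⟨ht.1, h1⟩)).2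
    have h3 : HasLaw (fun q : ℝ × ℝ => α t * q.1 + γ t * q.2)
        (densityMeasure (marginalDensity p₀ α γ t))
        ((gaussianReal 0 1).prod (densityMeasure p₀)) := ⟨by fun_prop, h2.symm⟩
    exact h3.comp (hindep.hasLaw_prod hz hx₀)

/-- The distribution functions `F_t(x)` are jointly continuous on `[0,1] × ℝ`. -/
lemma tendsto_marginalCDF (h : IsSchedule α γ) {t x : ℝ} (ht : t ∈ Icc (0 : ℝ) 1)
    {ι : Type*} {l : Filter ι} [l.IsCountablyGenerated] {s y : ι → ℝ}
    (hs : Tendsto s l (𝓝[Icc 0 1] t)) (hy : Tendsto y l (𝓝 x)) :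
    Tendsto (fun i => marginalCDF p₀ α γ (s i) (y i)) l (𝓝 (marginalCDF p₀ α γ t x)) := by
  -- Writing every `F_s` as an expectation on the same probability space treats `s → 1` like any
  -- other limit, although the density formula degenerates there.
  have hrep : ∀ s ∈ Icc (0 : ℝ) 1, ∀ y, marginalCDF p₀ α γ s y
      = ∫ ω, (Iic y).indicator (fun _ => (1 : ℝ)) (forwardProcess α γ z x₀ s ω) ∂P := by
    intro s hs y
    have hlaw := hasLaw_forwardProcess hp hscore hz hx₀ hindep h hs
    have := hlaw.integral_comp (f := (Iic y).indicator (fun _ => (1 : ℝ)))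
      (measurable_const.indicator measurableSet_Iic).aestronglyMeasurable
    simp only [Function.comp_def] at this
    rw [this, integral_indicator_const _ measurableSet_Iic, smul_eq_mul, mul_one,
      (isPositiveDensity_marginalDensity hp hscore h hs).densityMeasure_real_Iic]
    rfl
  have hmem : ∀ᶠ i in l, s i ∈ Icc (0 : ℝ) 1 := hs.eventually eventually_mem_nhdsWithin
  have hlaw := hasLaw_forwardProcess hp hscore hz hx₀ hindep h ht
  -- Off this null event the indicators are eventually constant, so dominated convergence applies.
  have hne : ∀ᵐ ω ∂P, forwardProcess α γ z x₀ t ω ≠ x := by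
    have h0 : ∀ᵐ u ∂(densityMeasure (marginalDensity p₀ α γ t)), u ≠ x :=
      measure_mono_null (by intro u; simp)
        (IsPositiveDensity.densityMeasure_singleton (marginalDensity p₀ α γ t) x)
    exact (hlaw.ae_iff (p := fun u => u ≠ x) (by fun_prop)).2 h0
  rw [hrep t ht]
  refine Tendsto.congr' (hmem.mono fun i hi => (hrep (s i) hi (y i)).symm) ?_
  refine tendsto_integral_filter_of_dominated_convergence (fun _ => 1)
    (hmem.mono fun i hi => ?_) (.of_forall fun i => ae_of_all _ fun ω => ?_)
    (integrable_const _) ?_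
  · exact ((measurable_const.indicator measurableSet_Iic).comp_aemeasurable
      (hasLaw_forwardProcess hp hscore hz hx₀ hindep h hi).aemeasurable).aestronglyMeasurable
  · by_cases hω : forwardProcess α γ z x₀ (s i) ω ∈ Iic (y i) <;> simp [hω]
  · filter_upwards [hne] with ω hω
    have hα : Tendsto (fun i => α (s i)) l (𝓝 (α t)) :=
      (h.contDiffOn_α.continuousOn t ht).tendsto.comp hs
    have hγ : Tendsto (fun i => γ (s i)) l (𝓝 (γ t)) :=
      (h.contDiffOn_γ.continuousOn t ht).tendsto.comp hs
    have hX : Tendsto (fun i => forwardProcess α γ z x₀ (s i) ω) l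
        (𝓝 (forwardProcess α γ z x₀ t ω)) := (hα.mul_const _).add (hγ.mul_const _)
    refine tendsto_const_nhds.congr' ?_
    rcases lt_or_gt_of_ne hω with hlt | hlt
    · filter_upwards [hX.eventually_lt hy hlt] with i hi
      rw [indicator_of_mem (mem_Iic.2 hlt.le), indicator_of_mem (mem_Iic.2 hi.le)]
    · filter_upwards [hy.eventually_lt hX hlt] with i hi
      rw [indicator_of_notMem (notMem_Iic.2 hlt), indicator_of_notMem (notMem_Iic.2 hi)]

end

/-! ### The probability flux and the velocity field -/

/-- The probability flux `p_t(x) E[α'(t) z + γ'(t) x₀ | x_t = x]`. -/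
noncomputable def flux (p₀ α γ : ℝ → ℝ) (x t : ℝ) : ℝ :=
  ∫ z, (γ t)⁻¹ * (p₀ ((x - α t * z) / γ t)
    * (timeDeriv α t * z + timeDeriv γ t * ((x - α t * z) / γ t))) ∂(gaussianReal 0 1)

namespace IsSchedule

lemma continuousOn_timeDeriv_α (h : IsSchedule α γ) : ContinuousOn (timeDeriv α) (Icc 0 1) :=
  h.contDiffOn_α.continuousOn_derivWithin (uniqueDiffOn_Icc zero_lt_one) le_rfl

lemma continuousOn_timeDeriv_γ (h : IsSchedule α γ) : ContinuousOn (timeDeriv γ) (Icc 0 1) :=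
  h.contDiffOn_γ.continuousOn_derivWithin (uniqueDiffOn_Icc zero_lt_one) le_rfl

lemma hasDerivAt_α (h : IsSchedule α γ) {t : ℝ} (ht : t ∈ Ioo (0 : ℝ) 1) :
    HasDerivAt α (timeDeriv α t) t :=
  (h.contDiffOn_α.differentiableOn one_ne_zero t
    (Ioo_subset_Icc_self ht)).hasDerivWithinAt.hasDerivAt
    (Icc_mem_nhds ht.1 ht.2)

lemma hasDerivAt_γ (h : IsSchedule α γ) {t : ℝ} (ht : t ∈ Ioo (0 : ℝ) 1) :
    HasDerivAt γ (timeDeriv γ t) t :=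
  (h.contDiffOn_γ.differentiableOn one_ne_zero t
    (Ioo_subset_Icc_self ht)).hasDerivWithinAt.hasDerivAt
    (Icc_mem_nhds ht.1 ht.2)

end IsSchedule

section

variable (hp : IsPositiveDensity p₀) {A B : ℝ} (hscore : ∀ x, |score p₀ x| ≤ A + B * |x|)
include hp hscore

lemma integrable_mul_density_comp_affine (x a c : ℝ) :
    Integrable (fun z => z * p₀ ((x - a * z) / c)) (gaussianReal 0 1) := by
  obtain ⟨C, hC0, hC⟩ := exists_abs_le_linear hp hscore
  simpa using integrable_pow_mul_comp hp.continuous.measurable hC0 hC 1 x a c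

lemma integral_argument_mul_density (x a c : ℝ) :
    ∫ z, ((x - a * z) / c) * p₀ ((x - a * z) / c) ∂(gaussianReal 0 1)
      = (x * (∫ z, p₀ ((x - a * z) / c) ∂(gaussianReal 0 1))
        - a * ∫ z, z * p₀ ((x - a * z) / c) ∂(gaussianReal 0 1)) / c := by
  rw [← integral_const_mul, ← integral_const_mul,
    ← integral_sub ((integrable_density_comp_affine hp hscore x a c).const_mul x)
      ((integrable_mul_density_comp_affine hp hscore x a c).const_mul a), ← integral_div]
  congr 1 with z
  ring

/-- Reduces the flux to Gaussian averages of `p₀` with weights `1` and `z`, whose continuity is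
known. -/
lemma flux_eq (x t : ℝ) :
    flux p₀ α γ x t
      = (γ t)⁻¹ * (timeDeriv α t * (∫ z, z * p₀ ((x - α t * z) / γ t) ∂(gaussianReal 0 1))
        + timeDeriv γ t *
          ((x * (∫ z, p₀ ((x - α t * z) / γ t) ∂(gaussianReal 0 1))
            - α t * ∫ z, z * p₀ ((x - α t * z) / γ t) ∂(gaussianReal 0 1)) / γ t)) := by
  have i0 := integrable_density_comp_affine hp hscore x (α t) (γ t)
  have i1 := integrable_mul_density_comp_affine hp hscore x (α t) (γ t)
  have i2 : Integrable (fun z => ((x - α t * z) / γ t) * p₀ ((x - α t * z) / γ t))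
      (gaussianReal 0 1) :=
    (((i0.const_mul x).sub (i1.const_mul (α t))).div_const (γ t)).congr
      (ae_of_all _ fun z => by simp only [Pi.sub_apply]; ring)
  rw [← integral_argument_mul_density hp hscore, ← integral_const_mul, ← integral_const_mul,
    ← integral_add (i1.const_mul _) (i2.const_mul _), ← integral_const_mul, flux]
  congr 1 with z
  ring

/-- Integration by parts turns the average weighted by `z` into `-α` times the derivative of the
density, which is where the score in `v` comes from; the `x₀` term follows from `x₀ = (x - α z) /
γ`. -/
lemma velocity_mul_marginalDensity {t : ℝ} (ht : 0 < γ t) (x : ℝ) :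
    velocity p₀ α γ x t * marginalDensity p₀ α γ t x = flux p₀ α γ x t := by
  obtain ⟨C, hC0, hC⟩ := exists_abs_le_linear hp hscore
  obtain ⟨C', hC0', hC'⟩ := hp.exists_abs_deriv_le hscore
  have hpos := marginalDensity_pos (α := α) hp hscore ht x
  have hd := isPositiveDensity_marginalDensity_and_law (α := α) hp hscore ht
  have hstein := integral_mul_comp_affine hp.differentiable hC0 hC hC0' hC' x (α t) (γ t)
  rw [flux_eq hp hscore, hstein, velocity, hd.1.score_eq,
    (hasDerivAt_marginalDensity hp hscore ht x).deriv]
  have e := marginalDensity_eq (p₀ := p₀) (α := α) ht x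
  set D := ∫ z, deriv p₀ ((x - α t * z) / γ t) ∂(gaussianReal 0 1)
  set I := ∫ z, p₀ ((x - α t * z) / γ t) ∂(gaussianReal 0 1)
  set m := marginalDensity p₀ α γ t x
  have hI : I = γ t * m := by rw [e]; field_simp
  rw [hI]
  have h0 := ht.ne'
  have h1 := hpos.ne'
  field_simp
  ring

lemma velocity_eq {t : ℝ} (ht : 0 < γ t) (x : ℝ) :
    velocity p₀ α γ x t = flux p₀ α γ x t / marginalDensity p₀ α γ t x := by
  rw [← velocity_mul_marginalDensity hp hscore ht,
    mul_div_cancel_right₀ _ (marginalDensity_pos hp hscore ht x).ne']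

/-! ### Joint continuity of the density, the flux and the velocity before time one -/

section Continuity

variable (h : IsSchedule α γ) {t x : ℝ} (ht : t ∈ Ico (0 : ℝ) 1)
  {ι : Type*} {l : Filter ι} {s y : ι → ℝ}
  (hs : Tendsto s l (𝓝[Icc 0 1] t)) (hy : Tendsto y l (𝓝 x))
include h ht hs

omit hp hscore in
lemma eventually_γ_pos : ∀ᶠ i in l, 0 < γ (s i) := by
  filter_upwards [hs.eventually eventually_mem_nhdsWithin,
    (hs.mono_right nhdsWithin_le_nhds).eventually_lt_const ht.2] with i h1 h2
  exact h.γ_pos ⟨h1.1, h2⟩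

include hy

lemma tendsto_integral_pow_mul_density (k : ℕ) :
    Tendsto (fun i => ∫ z, z ^ k * p₀ ((y i - α (s i) * z) / γ (s i)) ∂(gaussianReal 0 1)) l
      (𝓝 (∫ z, z ^ k * p₀ ((x - α t * z) / γ t) ∂(gaussianReal 0 1))) := by
  obtain ⟨C, hC0, hC⟩ := exists_abs_le_linear hp hscore
  have hα : Tendsto (fun i => α (s i)) l (𝓝 (α t)) :=
    (h.contDiffOn_α.continuousOn t (Ico_subset_Icc_self ht)).tendsto.comp hs
  have hγ : Tendsto (fun i => γ (s i)) l (𝓝 (γ t)) :=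
    (h.contDiffOn_γ.continuousOn t (Ico_subset_Icc_self ht)).tendsto.comp hs
  exact (continuousAt_integral_pow_mul_comp hp.continuous hC0 hC k x (α t)
    (h.γ_pos ht).ne').tendsto.comp (hy.prodMk_nhds (hα.prodMk_nhds hγ))

lemma tendsto_marginalDensity :
    Tendsto (fun i => marginalDensity p₀ α γ (s i) (y i)) l (𝓝 (marginalDensity p₀ α γ t x)) := by
  have hγ : Tendsto (fun i => γ (s i)) l (𝓝 (γ t)) :=
    (h.contDiffOn_γ.continuousOn t (Ico_subset_Icc_self ht)).tendsto.comp hs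
  have h0 := tendsto_integral_pow_mul_density hp hscore h ht hs hy 0
  simp only [pow_zero, one_mul] at h0
  rw [marginalDensity_eq (h.γ_pos ht)]
  refine ((hγ.inv₀ (h.γ_pos ht).ne').mul h0).congr' ?_
  filter_upwards [eventually_γ_pos h ht hs] with i hi
  rw [marginalDensity_eq hi]

lemma tendsto_flux : Tendsto (fun i => flux p₀ α γ (y i) (s i)) l (𝓝 (flux p₀ α γ x t)) := by
  have hα : Tendsto (fun i => α (s i)) l (𝓝 (α t)) :=
    (h.contDiffOn_α.continuousOn t (Ico_subset_Icc_self ht)).tendsto.comp hs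
  have hγ : Tendsto (fun i => γ (s i)) l (𝓝 (γ t)) :=
    (h.contDiffOn_γ.continuousOn t (Ico_subset_Icc_self ht)).tendsto.comp hs
  have hα' := (h.continuousOn_timeDeriv_α t (Ico_subset_Icc_self ht)).tendsto.comp hs
  have hγ' := (h.continuousOn_timeDeriv_γ t (Ico_subset_Icc_self ht)).tendsto.comp hs
  have h0 := tendsto_integral_pow_mul_density hp hscore h ht hs hy 0
  have h1 := tendsto_integral_pow_mul_density hp hscore h ht hs hy 1
  simp only [pow_zero, one_mul, pow_one] at h0 h1
  have hne := (h.γ_pos ht).ne'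
  simp_rw [flux_eq hp hscore]
  exact (hγ.inv₀ hne).mul ((hα'.mul h1).add (hγ'.mul (((hy.mul h0).sub (hα.mul h1)).div hγ hne)))

lemma tendsto_velocity :
    Tendsto (fun i => velocity p₀ α γ (y i) (s i)) l (𝓝 (velocity p₀ α γ x t)) := by
  have hpos := h.γ_pos ht
  rw [velocity_eq hp hscore hpos]
  refine ((tendsto_flux hp hscore h ht hs hy).div (tendsto_marginalDensity hp hscore h ht hs hy)
    (marginalDensity_pos hp hscore hpos x).ne').congr' ?_
  filter_upwards [eventually_γ_pos h ht hs] with i hi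
  rw [velocity_eq hp hscore hi]
  rfl

end Continuity

/-- The continuity equation, integrated in space: `∂ₜ F_t(x) = - v(x,t) p_t(x)`. -/
lemma hasDerivAt_marginalCDF_time (h : IsSchedule α γ) {t : ℝ} (ht : t ∈ Ioo (0 : ℝ) 1) (x : ℝ) :
    HasDerivAt (fun s => marginalCDF p₀ α γ s x) (-flux p₀ α γ x t) t := by
  obtain ⟨C, hC0, hC⟩ := exists_abs_le_linear hp hscore
  -- A compact neighbourhood `[a, b]` of `t` inside `(0,1)` bounds `α`, `1 / γ`, `α'` and `γ'`
  -- uniformly.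
  obtain ⟨a, ha0, hat⟩ := exists_between ht.1
  obtain ⟨b, htb, hb1⟩ := exists_between ht.2
  have hsub : Icc a b ⊆ Ioo (0 : ℝ) 1 := Icc_subset_Ioo ha0 hb1
  have hsub' : Icc a b ⊆ Icc (0 : ℝ) 1 := hsub.trans Ioo_subset_Icc_self
  have hγpos : ∀ u ∈ Icc a b, 0 < γ u := fun u hu => h.γ_pos (Ioo_subset_Ico_self (hsub hu))
  have bdd : ∀ f : ℝ → ℝ, ContinuousOn f (Icc a b) → ∃ R, ∀ u ∈ Icc a b, |f u| ≤ R :=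
    fun f hf => isCompact_Icc.exists_bound_of_continuousOn hf
  obtain ⟨R₁, hR₁⟩ := bdd α (h.contDiffOn_α.continuousOn.mono hsub')
  obtain ⟨R₂, hR₂⟩ := bdd (fun u => (γ u)⁻¹) ((h.contDiffOn_γ.continuousOn.mono hsub').inv₀
    fun u hu => (hγpos u hu).ne')
  obtain ⟨R₃, hR₃⟩ := bdd _ (h.continuousOn_timeDeriv_α.mono hsub')
  obtain ⟨R₄, hR₄⟩ := bdd _ (h.continuousOn_timeDeriv_γ.mono hsub')
  set R := max |x| (max (max R₁ R₂) (max R₃ R₄)) with hR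
  have key := hasDerivAt_integral_comp_path (f := fun w => ∫ u in Iic w, p₀ u) hp.hasDerivAt_cdf
    hp.continuous.measurable zero_le_one (abs_cdf_le hp) hC0 hC x (R := R)
    (Icc_mem_nhds hat htb) (fun u hu => h.hasDerivAt_α (hsub hu))
    (fun u hu => h.hasDerivAt_γ (hsub hu)) (fun u hu => (hγpos u hu).ne') (le_max_left _ _)
    (fun u hu => (hR₁ u hu).trans (by simp [hR])) (fun u hu => (hR₂ u hu).trans (by simp [hR]))
    (fun u hu => (hR₃ u hu).trans (by simp [hR])) (fun u hu => (hR₄ u hu).trans (by simp [hR]))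
  refine key.congr_of_eventuallyEq ?_
  filter_upwards [Icc_mem_nhds hat htb] with u hu
  rw [marginalCDF_eq hp hscore (hγpos u hu)]

lemma hasDerivAt_marginalCDF_space (h : IsSchedule α γ) {t : ℝ} (ht : t ∈ Icc (0 : ℝ) 1) (x : ℝ) :
    HasDerivAt (marginalCDF p₀ α γ t) (marginalDensity p₀ α γ t x) x :=
  (isPositiveDensity_marginalDensity hp hscore h ht).hasDerivAt_cdf x

/-! ### Differentiating the distribution function along a curve -/

/-- A chain rule for curves known only to be continuous at `t`: the mean value theorem in space
gives `k s = p_s(ξ s)` with `ξ s` between `y t` and `y s`, and joint continuity of the density gives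
the limit. -/
lemma exists_tendsto_slope_marginalCDF (h : IsSchedule α γ) {t : ℝ} (ht : t ∈ Ioo (0 : ℝ) 1)
    {y : ℝ → ℝ} (hy : ContinuousAt y t) :
    ∃ k : ℝ → ℝ, Tendsto k (𝓝 t) (𝓝 (marginalDensity p₀ α γ t (y t))) ∧
      ∀ᶠ s in 𝓝 t, 0 < k s ∧ marginalCDF p₀ α γ s (y s) - marginalCDF p₀ α γ s (y t)
        = k s * (y s - y t) := by
  have hex : ∀ s ∈ Icc (0 : ℝ) 1, ∃ ξ ∈ uIcc (y t) (y s),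
      marginalCDF p₀ α γ s (y s) - marginalCDF p₀ α γ s (y t)
        = marginalDensity p₀ α γ s ξ * (y s - y t) := by
    intro s hs
    have hd := hasDerivAt_marginalCDF_space hp hscore h hs
    have hc : Continuous (marginalCDF p₀ α γ s) :=
      continuous_iff_continuousAt.2 fun x => (hd x).continuousAt
    rcases lt_trichotomy (y t) (y s) with hlt | heq | hlt
    · obtain ⟨ξ, hξ, e⟩ := exists_hasDerivAt_eq_slope _ _ hlt hc.continuousOn fun x _ => hd x
      refine ⟨ξ, Icc_subset_uIcc (Ioo_subset_Icc_self hξ), ?_⟩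
      rw [e, div_mul_cancel₀ _ (sub_pos.2 hlt).ne']
    · exact ⟨y t, left_mem_uIcc, by rw [heq]; simp⟩
    · obtain ⟨ξ, hξ, e⟩ := exists_hasDerivAt_eq_slope _ _ hlt hc.continuousOn fun x _ => hd x
      refine ⟨ξ, Icc_subset_uIcc' (Ioo_subset_Icc_self hξ), ?_⟩
      rw [e, ← neg_sub (y t) (y s), mul_neg, div_mul_cancel₀ _ (sub_pos.2 hlt).ne', neg_sub]
  choose! ξ hξ hξe using hex
  have hmem : ∀ᶠ s in 𝓝 t, s ∈ Icc (0 : ℝ) 1 := Icc_mem_nhds ht.1 ht.2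
  have hξt : Tendsto ξ (𝓝 t) (𝓝 (y t)) := by
    rw [tendsto_iff_dist_tendsto_zero]
    have hd : Tendsto (fun s => dist (y s) (y t)) (𝓝 t) (𝓝 0) :=
      tendsto_iff_dist_tendsto_zero.1 hy
    refine squeeze_zero' (.of_forall fun _ => dist_nonneg) ?_ hd
    filter_upwards [hmem] with s hs
    rw [Real.dist_eq, Real.dist_eq]
    exact abs_sub_left_of_mem_uIcc (hξ s hs)
  refine ⟨fun s => marginalDensity p₀ α γ s (ξ s), ?_, ?_⟩
  · refine tendsto_marginalDensity hp hscore h (Ioo_subset_Ico_self ht) (s := fun s => s) ?_ hξt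
    exact tendsto_nhdsWithin_iff.2 ⟨tendsto_id, hmem⟩
  · filter_upwards [hmem] with s hs
    exact ⟨(isPositiveDensity_marginalDensity hp hscore h hs).pos _, hξe s hs⟩

/-- Implicit differentiation: constancy gives `k s * (y s - y t) = F_t(y t) - F_s(y t)`. Dividing by
`s - t` and by `k s` yields flux over density, which is the velocity. -/
lemma hasDerivAt_of_marginalCDF_const (h : IsSchedule α γ) {t : ℝ} (ht : t ∈ Ioo (0 : ℝ) 1)
    {y : ℝ → ℝ} (hy : ContinuousAt y t) {c : ℝ}
    (hc : ∀ s ∈ Icc (0 : ℝ) 1, marginalCDF p₀ α γ s (y s) = c) :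
    HasDerivAt y (velocity p₀ α γ (y t) t) t := by
  obtain ⟨k, hk, hks⟩ := exists_tendsto_slope_marginalCDF hp hscore h ht hy
  have htime := hasDerivAt_iff_tendsto_slope.1
    (hasDerivAt_marginalCDF_time hp hscore h ht (y t))
  have hpos := h.γ_pos (Ioo_subset_Ico_self ht)
  rw [hasDerivAt_iff_tendsto_slope, velocity_eq hp hscore hpos]
  have := htime.neg.div (hk.mono_left nhdsWithin_le_nhds)
    (marginalDensity_pos hp hscore hpos (y t)).ne'
  rw [neg_neg] at this
  refine this.congr' ?_
  filter_upwards [nhdsWithin_le_nhds hks, nhdsWithin_le_nhds (Icc_mem_nhds ht.1 ht.2)]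
    with s hs hmem
  rw [hc s hmem, ← hc t (Ioo_subset_Icc_self ht)] at hs
  rw [Pi.div_apply, div_eq_iff hs.1.ne', slope_def_field, slope_def_field, div_mul_eq_mul_div, mul_comm (_ - _),
    ← hs.2, ← neg_div, neg_sub]

lemma hasDerivAt_marginalCDF_along (h : IsSchedule α γ) {t : ℝ} (ht : t ∈ Ioo (0 : ℝ) 1)
    {y : ℝ → ℝ} (hy : HasDerivAt y (velocity p₀ α γ (y t) t) t) :
    HasDerivAt (fun s => marginalCDF p₀ α γ s (y s)) 0 t := by
  obtain ⟨k, hk, hks⟩ := exists_tendsto_slope_marginalCDF hp hscore h ht hy.continuousAt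
  have htime := hasDerivAt_iff_tendsto_slope.1
    (hasDerivAt_marginalCDF_time hp hscore h ht (y t))
  have hpos := h.γ_pos (Ioo_subset_Ico_self ht)
  rw [hasDerivAt_iff_tendsto_slope] at hy ⊢
  have := ((hk.mono_left nhdsWithin_le_nhds).mul hy).add htime
  rw [mul_comm (marginalDensity _ _ _ _ _), velocity_mul_marginalDensity hp hscore hpos,
    add_neg_cancel] at this
  refine this.congr' ?_
  filter_upwards [nhdsWithin_le_nhds hks] with s hs
  rw [slope_def_field, slope_def_field, slope_def_field, ← mul_div_assoc, ← hs.2, ← add_div]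
  congr 1
  ring

end

/-! ### The velocity field near the terminal time -/

lemma gaussianPDFReal_zero_one_le_one (x : ℝ) : gaussianPDFReal 0 1 x ≤ 1 := by
  rw [gaussianPDFReal]
  refine mul_le_one₀ (inv_le_one_of_one_le₀ ?_) (Real.exp_pos _).le (Real.exp_le_one_iff.2 ?_)
  · rw [Real.one_le_sqrt]
    simp only [NNReal.coe_one, mul_one]
    linarith [Real.pi_gt_three]
  · simp only [sub_zero, NNReal.coe_one, mul_one]
    have := sq_nonneg x
    linarith

lemma continuous_gaussianPDFReal_zero_one : Continuous (gaussianPDFReal 0 1) :=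
  isPositiveDensity_gaussianPDFReal.continuous

/-- Exchanging the two independent variables of `x = a z + c y` in a Gaussian average. -/
lemma integral_gaussianReal_comp_affine (f : ℝ → ℝ) (x : ℝ) {a c : ℝ} (ha : 0 < a) (hc : 0 < c) :
    ∫ z, f ((x - a * z) / c) ∂(gaussianReal 0 1)
      = c / a * ∫ y, gaussianPDFReal 0 1 ((x - c * y) / a) * f y := by
  set G : ℝ → ℝ := fun z => gaussianPDFReal 0 1 z * f ((x - a * z) / c) with hG
  have e : (fun y => gaussianPDFReal 0 1 ((x - c * y) / a) * f y)
      = fun y => G ((x - c * y) / a) := by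
    ext y
    have : (x - a * ((x - c * y) / a)) / c = y := by field_simp; ring
    simp only [hG, this]
  rw [e, Measure.integral_comp_mul_left (fun u => G ((x - u) / a)) c,
    integral_sub_left_eq_self (fun u => G (u / a)) volume x, Measure.integral_comp_div G a,
    integral_gaussianReal_eq, abs_of_pos ha, abs_of_pos (inv_pos.2 hc), smul_eq_mul, smul_eq_mul]
  field_simp
  rfl

/-- Only `a` is divided by, so `c = 0` is allowed, as needed at time one. The Gaussian density is at
most one, so `|f|` dominates. -/
lemma continuousAt_integral_gaussianPDFReal_mul {f : ℝ → ℝ} (hf : Integrable f) (x c : ℝ) {a : ℝ}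
    (ha : a ≠ 0) :
    ContinuousAt (fun q : ℝ × ℝ × ℝ =>
      ∫ y, gaussianPDFReal 0 1 ((q.1 - q.2.2 * y) / q.2.1) * f y) (x, a, c) := by
  refine continuousAt_of_dominated (bound := fun y => |f y|) (.of_forall fun q => ?_)
    (.of_forall fun q => ae_of_all _ fun y => ?_) hf.abs (ae_of_all _ fun y => ?_)
  · exact ((measurable_gaussianPDFReal 0 1).comp (by fun_prop)).aestronglyMeasurable.mul
      hf.aestronglyMeasurable
  · rw [norm_mul, Real.norm_of_nonneg (gaussianPDFReal_nonneg 0 1 _), Real.norm_eq_abs]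
    exact mul_le_of_le_one_left (abs_nonneg _) (gaussianPDFReal_zero_one_le_one _)
  · refine ContinuousAt.mul (ContinuousAt.comp' (g := gaussianPDFReal 0 1)
      continuous_gaussianPDFReal_zero_one.continuousAt ?_) continuousAt_const
    exact ContinuousAt.div (by fun_prop) (by fun_prop) ha

section

variable (hp : IsPositiveDensity p₀) {A B : ℝ} (hscore : ∀ x, |score p₀ x| ≤ A + B * |x|)
include hp hscore

/-- The same conditional mean, now averaged over `x₀` with `z = (x - γ y) / α`: no division by `γ`
remains. -/
lemma velocity_eq_of_pos {t : ℝ} (hα : 0 < α t) (hγ : 0 < γ t) (x : ℝ) :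
    velocity p₀ α γ x t
      = (timeDeriv α t *
          ((x * (∫ y, gaussianPDFReal 0 1 ((x - γ t * y) / α t) * p₀ y)
            - γ t * ∫ y, gaussianPDFReal 0 1 ((x - γ t * y) / α t) * (y * p₀ y)) / α t)
        + timeDeriv γ t * ∫ y, gaussianPDFReal 0 1 ((x - γ t * y) / α t) * (y * p₀ y))
        / ∫ y, gaussianPDFReal 0 1 ((x - γ t * y) / α t) * p₀ y := by
  have hI := integral_gaussianReal_comp_affine p₀ x hα hγ
  have hW := integral_gaussianReal_comp_affine (fun y => y * p₀ y) x hα hγ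
  have hm := marginalDensity_eq (p₀ := p₀) (α := α) hγ x
  have hpos := marginalDensity_pos (α := α) hp hscore hγ x
  have hr := integral_argument_mul_density hp hscore x (α t) (γ t)
  rw [velocity_eq hp hscore hγ, flux_eq hp hscore, ← hr]
  rw [hW, hI] at hr
  rw [hm, hI] at hpos
  rw [hm, hW, hI]
  set J₀ := ∫ y, gaussianPDFReal 0 1 ((x - γ t * y) / α t) * p₀ y
  set J₁ := ∫ y, gaussianPDFReal 0 1 ((x - γ t * y) / α t) * (y * p₀ y)
  set Z := ∫ z, z * p₀ ((x - α t * z) / γ t) ∂(gaussianReal 0 1)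
  have hα0 := hα.ne'
  have hγ0 := hγ.ne'
  have hJ : J₀ ≠ 0 := by
    rintro hJ
    simp [hJ] at hpos
  have hZ : Z = γ t / α t * ((x * J₀ - γ t * J₁) / α t) := by
    field_simp at hr ⊢
    linarith
  rw [hZ]
  field_simp

/-- As `γ → 0` and `α → 1` the Gaussian weight becomes `φ(x)`, independent of `y`, and cancels:
given `x_1 = x`, the variable `x₀` keeps its unconditional mean. -/
lemma tendsto_velocity_one (h : IsSchedule α γ) (hpint : Integrable (fun x => x * p₀ x)) {x : ℝ}
    {ι : Type*} {l : Filter ι} {s y : ι → ℝ}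
    (hs : Tendsto s l (𝓝[Ico 0 1] 1)) (hy : Tendsto y l (𝓝 x)) :
    Tendsto (fun i => velocity p₀ α γ (y i) (s i)) l
      (𝓝 (timeDeriv α 1 * x + timeDeriv γ 1 * ∫ x, x * p₀ x)) := by
  have h1 : (1 : ℝ) ∈ Icc (0 : ℝ) 1 := right_mem_Icc.2 zero_le_one
  have hs' : Tendsto s l (𝓝[Icc 0 1] 1) := hs.mono_right (nhdsWithin_mono _ Ico_subset_Icc_self)
  have hα : Tendsto (fun i => α (s i)) l (𝓝 1) := by
    have := (h.contDiffOn_α.continuousOn 1 h1).tendsto.comp hs'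
    rwa [h.α_one] at this
  have hγ : Tendsto (fun i => γ (s i)) l (𝓝 0) := by
    have := (h.contDiffOn_γ.continuousOn 1 h1).tendsto.comp hs'
    rwa [h.γ_one] at this
  have hα' := (h.continuousOn_timeDeriv_α 1 h1).tendsto.comp hs'
  have hγ' := (h.continuousOn_timeDeriv_γ 1 h1).tendsto.comp hs'
  have hq := hy.prodMk_nhds (hα.prodMk_nhds hγ)
  have hJ₀ := (continuousAt_integral_gaussianPDFReal_mul hp.integrable x 0
    one_ne_zero).tendsto.comp hq
  have hJ₁ := (continuousAt_integral_gaussianPDFReal_mul hpint x 0 one_ne_zero).tendsto.comp hq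
  simp only [zero_mul, sub_zero, div_one, integral_const_mul, hp.integral_eq_one, mul_one,
    Function.comp_def] at hJ₀ hJ₁
  have hφ := (gaussianPDFReal_pos 0 1 x one_ne_zero).ne'
  have key := ((hα'.mul (((hy.mul hJ₀).sub (hγ.mul hJ₁)).div hα one_ne_zero)).add
    (hγ'.mul hJ₁)).div hJ₀ hφ
  have e : (timeDeriv α 1 * ((x * gaussianPDFReal 0 1 x
      - 0 * (gaussianPDFReal 0 1 x * ∫ x, x * p₀ x)) / 1)
      + timeDeriv γ 1 * (gaussianPDFReal 0 1 x * ∫ x, x * p₀ x)) / gaussianPDFReal 0 1 x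
      = timeDeriv α 1 * x + timeDeriv γ 1 * ∫ x, x * p₀ x := by
    field_simp
    ring
  rw [e] at key
  refine key.congr' ?_
  filter_upwards [hα.eventually_const_lt zero_lt_one, hs.eventually eventually_mem_nhdsWithin]
    with i hi hi'
  rw [velocity_eq_of_pos hp hscore hi (h.γ_pos hi')]
  rfl

end

/-! ### The backward flow -/

/-- The backward flow, `x_t = F_t⁻¹(F_1(x₁))`. -/
noncomputable def backwardFlow (p₀ α γ : ℝ → ℝ) (x₁ t : ℝ) : ℝ :=
  Function.invFun (marginalCDF p₀ α γ t) (marginalCDF p₀ α γ 1 x₁)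

lemma contDiffOn_one_of_hasDerivWithinAt {f f' : ℝ → ℝ} {s : Set ℝ} (hs : UniqueDiffOn ℝ s)
    (hf : ∀ t ∈ s, HasDerivWithinAt f (f' t) s t) (hf' : ContinuousOn f' s) :
    ContDiffOn ℝ 1 f s := by
  rw [contDiffOn_one_iff_derivWithin hs]
  exact ⟨fun t ht => (hf t ht).differentiableWithinAt,
    hf'.congr fun t ht => (hf t ht).derivWithin (hs t ht)⟩

section

variable (hp : IsPositiveDensity p₀) {A B : ℝ} (hscore : ∀ x, |score p₀ x| ≤ A + B * |x|)
  (h : IsSchedule α γ)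
include hp hscore h

lemma strictMono_marginalCDF {t : ℝ} (ht : t ∈ Icc (0 : ℝ) 1) :
    StrictMono (marginalCDF p₀ α γ t) :=
  (isPositiveDensity_marginalDensity hp hscore h ht).strictMono_cdf

lemma bijOn_marginalCDF {t : ℝ} (ht : t ∈ Icc (0 : ℝ) 1) :
    BijOn (marginalCDF p₀ α γ t) univ (Ioo 0 1) :=
  (isPositiveDensity_marginalDensity hp hscore h ht).bijOn_cdf

lemma marginalCDF_mem_Ioo {t : ℝ} (ht : t ∈ Icc (0 : ℝ) 1) (x : ℝ) :
    marginalCDF p₀ α γ t x ∈ Ioo (0 : ℝ) 1 :=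
  (isPositiveDensity_marginalDensity hp hscore h ht).cdf_mem_Ioo x

lemma marginalCDF_backwardFlow (x₁ : ℝ) {t : ℝ} (ht : t ∈ Icc (0 : ℝ) 1) :
    marginalCDF p₀ α γ t (backwardFlow p₀ α γ x₁ t) = marginalCDF p₀ α γ 1 x₁ :=
  Function.invFun_eq ((isPositiveDensity_marginalDensity hp hscore h ht).exists_cdf_eq
    (marginalCDF_mem_Ioo hp hscore h (right_mem_Icc.2 zero_le_one) x₁))

lemma backwardFlow_one (x₁ : ℝ) : backwardFlow p₀ α γ x₁ 1 = x₁ :=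
  Function.leftInverse_invFun
    (strictMono_marginalCDF hp hscore h (right_mem_Icc.2 zero_le_one)).injective x₁

lemma strictMono_backwardFlow {t : ℝ} (ht : t ∈ Icc (0 : ℝ) 1) :
    StrictMono (fun x₁ => backwardFlow p₀ α γ x₁ t) := fun x y hxy => by
  rw [← (strictMono_marginalCDF hp hscore h ht).lt_iff_lt,
    marginalCDF_backwardFlow hp hscore h x ht, marginalCDF_backwardFlow hp hscore h y ht]
  exact strictMono_marginalCDF hp hscore h (right_mem_Icc.2 zero_le_one) hxy

variable {Ω : Type*} [MeasurableSpace Ω] {P : Measure Ω} [IsProbabilityMeasure P] {z x₀ : Ω → ℝ}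
  (hz : HasLaw z (gaussianReal 0 1) P) (hx₀ : HasLaw x₀ (densityMeasure p₀) P)
  (hindep : IndepFun z x₀ P)
include hz hx₀ hindep

/-- For `a < x_t` the strict inequality `F_t(a) < F_1(x₁)` persists at nearby times `s`, where
monotonicity of `F_s` turns it back into `a < x_s`; likewise from above. -/
lemma continuousOn_backwardFlow (x₁ : ℝ) :
    ContinuousOn (backwardFlow p₀ α γ x₁) (Icc 0 1) := fun t ht => by
  have htend : ∀ a, Tendsto (fun s => marginalCDF p₀ α γ s a) (𝓝[Icc 0 1] t)
      (𝓝 (marginalCDF p₀ α γ t a)) := fun a =>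
    tendsto_marginalCDF hp hscore hz hx₀ hindep h ht tendsto_id tendsto_const_nhds
  refine tendsto_order.2 ⟨fun a ha => ?_, fun a ha => ?_⟩
  · have := strictMono_marginalCDF hp hscore h ht ha
    rw [marginalCDF_backwardFlow hp hscore h x₁ ht] at this
    filter_upwards [(htend a).eventually_lt_const this, eventually_mem_nhdsWithin] with s hs hmem
    rwa [← marginalCDF_backwardFlow hp hscore h x₁ hmem,
      (strictMono_marginalCDF hp hscore h hmem).lt_iff_lt] at hs
  · have := strictMono_marginalCDF hp hscore h ht ha
    rw [marginalCDF_backwardFlow hp hscore h x₁ ht] at this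
    filter_upwards [(htend a).eventually_const_lt this, eventually_mem_nhdsWithin] with s hs hmem
    rwa [← marginalCDF_backwardFlow hp hscore h x₁ hmem,
      (strictMono_marginalCDF hp hscore h hmem).lt_iff_lt] at hs

lemma hasDerivAt_backwardFlow (x₁ : ℝ) {t : ℝ} (ht : t ∈ Ioo (0 : ℝ) 1) :
    HasDerivAt (backwardFlow p₀ α γ x₁) (velocity p₀ α γ (backwardFlow p₀ α γ x₁ t) t) t :=
  hasDerivAt_of_marginalCDF_const hp hscore h ht
    ((continuousOn_backwardFlow hp hscore h hz hx₀ hindep x₁).continuousAt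
      (Icc_mem_nhds ht.1 ht.2))
    fun _ hs => marginalCDF_backwardFlow hp hscore h x₁ hs

lemma differentiableOn_backwardFlow (x₁ : ℝ) :
    DifferentiableOn ℝ (backwardFlow p₀ α γ x₁) (Ioo 0 1) := fun _ ht =>
  (hasDerivAt_backwardFlow hp hscore h hz hx₀ hindep x₁ ht).differentiableAt.differentiableWithinAt

lemma continuousOn_velocity_backwardFlow (x₁ : ℝ) :
    ContinuousOn (fun t => velocity p₀ α γ (backwardFlow p₀ α γ x₁ t) t) (Ico 0 1) :=
  fun t ht => tendsto_velocity hp hscore h ht (s := fun s => s)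
    (tendsto_id.mono_left (nhdsWithin_mono _ Ico_subset_Icc_self))
    ((continuousOn_backwardFlow hp hscore h hz hx₀ hindep x₁ t (Ico_subset_Icc_self ht)).mono_left
      (nhdsWithin_mono _ Ico_subset_Icc_self))

lemma hasDerivWithinAt_backwardFlow (x₁ : ℝ) {t : ℝ} (ht : t ∈ Ico (0 : ℝ) 1) :
    HasDerivWithinAt (backwardFlow p₀ α γ x₁)
      (velocity p₀ α γ (backwardFlow p₀ α γ x₁ t) t) (Icc 0 1) t := by
  rcases ht.1.eq_or_lt with rfl | h0
  -- At `t = 0` the one-sided derivative is the limit of the interior derivatives.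
  · have hmem : Ioo (0 : ℝ) 1 ∈ 𝓝[>] (0 : ℝ) := Ioo_mem_nhdsGT zero_lt_one
    refine (hasDerivWithinAt_Ici_of_tendsto_deriv
      (differentiableOn_backwardFlow hp hscore h hz hx₀ hindep x₁)
      ((continuousOn_backwardFlow hp hscore h hz hx₀ hindep x₁ 0
        (left_mem_Icc.2 zero_le_one)).mono Ioo_subset_Icc_self) hmem ?_).mono Icc_subset_Ici_self
    have hle : 𝓝[>] (0 : ℝ) ≤ 𝓝[Ico 0 1] 0 := by
      rw [← nhdsWithin_Ioo_eq_nhdsGT zero_lt_one]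
      exact nhdsWithin_mono _ Ioo_subset_Ico_self
    refine ((continuousOn_velocity_backwardFlow hp hscore h hz hx₀ hindep x₁ 0 ht).tendsto.mono_left
      hle).congr' ?_
    filter_upwards [hmem] with s hs
    exact (hasDerivAt_backwardFlow hp hscore h hz hx₀ hindep x₁ hs).deriv.symm
  · exact (hasDerivAt_backwardFlow hp hscore h hz hx₀ hindep x₁ ⟨h0, ht.2⟩).hasDerivWithinAt

lemma isBackwardSolution_backwardFlow (x₁ : ℝ) :
    IsBackwardSolution p₀ α γ x₁ (backwardFlow p₀ α γ x₁) :=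
  ⟨continuousOn_backwardFlow hp hscore h hz hx₀ hindep x₁, backwardFlow_one hp hscore h x₁,
    fun _ ht => hasDerivWithinAt_backwardFlow hp hscore h hz hx₀ hindep x₁ ht⟩

/-- Along any solution `F_s(y s)` has zero derivative inside and is continuous up to `s = 1`, so it
equals `F_1(x₁)`; injectivity of `F_t` then determines `y t`. -/
lemma eqOn_backwardFlow {x₁ : ℝ} {y : ℝ → ℝ} (hy : IsBackwardSolution p₀ α γ x₁ y) :
    EqOn y (backwardFlow p₀ α γ x₁) (Icc 0 1) := by
  have hcont : ContinuousOn (fun s => marginalCDF p₀ α γ s (y s)) (Icc 0 1) := fun t ht =>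
    tendsto_marginalCDF hp hscore hz hx₀ hindep h ht tendsto_id (hy.continuousOn t ht)
  have hder : ∀ t ∈ Ioo (0 : ℝ) 1, HasDerivAt (fun s => marginalCDF p₀ α γ s (y s)) 0 t :=
    fun t ht => hasDerivAt_marginalCDF_along hp hscore h ht
      ((hy.hasDerivWithinAt t (Ioo_subset_Ico_self ht)).hasDerivAt (Icc_mem_nhds ht.1 ht.2))
  intro t ht
  refine (strictMono_marginalCDF hp hscore h ht).injective ?_
  rw [marginalCDF_backwardFlow hp hscore h x₁ ht]
  rcases ht.2.eq_or_lt with rfl | h1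
  · rw [hy.terminal]
  · obtain ⟨s, hs, e⟩ := exists_hasDerivAt_eq_slope _ (fun _ => (0 : ℝ)) h1
      (hcont.mono (Icc_subset_Icc_left ht.1)) fun s hs => hder s ⟨ht.1.trans_lt hs.1, hs.2⟩
    rw [eq_comm, div_eq_zero_iff, sub_eq_zero, sub_eq_zero, or_iff_left h1.ne', hy.terminal] at e
    exact e.symm

lemma contDiffOn_backwardFlow_Ico (x₁ : ℝ) :
    ContDiffOn ℝ 1 (backwardFlow p₀ α γ x₁) (Ico 0 1) :=
  contDiffOn_one_of_hasDerivWithinAt (uniqueDiffOn_Ico 0 1)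
    (fun _ ht => (hasDerivWithinAt_backwardFlow hp hscore h hz hx₀ hindep x₁ ht).mono
      Ico_subset_Icc_self)
    (continuousOn_velocity_backwardFlow hp hscore h hz hx₀ hindep x₁)

variable (hpint : Integrable (fun x => x * p₀ x))
include hpint

lemma tendsto_velocity_backwardFlow_one (x₁ : ℝ) :
    Tendsto (fun t => velocity p₀ α γ (backwardFlow p₀ α γ x₁ t) t) (𝓝[Ico 0 1] 1)
      (𝓝 (timeDeriv α 1 * x₁ + timeDeriv γ 1 * ∫ x, x * p₀ x)) := by
  refine tendsto_velocity_one hp hscore h hpint tendsto_id ?_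
  have := (continuousOn_backwardFlow hp hscore h hz hx₀ hindep x₁ 1
    (right_mem_Icc.2 zero_le_one)).tendsto.mono_left (nhdsWithin_mono _ Ico_subset_Icc_self)
  rwa [backwardFlow_one hp hscore h] at this

lemma hasDerivWithinAt_backwardFlow_one (x₁ : ℝ) :
    HasDerivWithinAt (backwardFlow p₀ α γ x₁)
      (timeDeriv α 1 * x₁ + timeDeriv γ 1 * ∫ x, x * p₀ x) (Icc 0 1) 1 := by
  have hmem : Ioo (0 : ℝ) 1 ∈ 𝓝[<] (1 : ℝ) := Ioo_mem_nhdsLT zero_lt_one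
  refine (hasDerivWithinAt_Iic_of_tendsto_deriv
    (differentiableOn_backwardFlow hp hscore h hz hx₀ hindep x₁)
    ((continuousOn_backwardFlow hp hscore h hz hx₀ hindep x₁ 1
      (right_mem_Icc.2 zero_le_one)).mono Ioo_subset_Icc_self) hmem ?_).mono Icc_subset_Iic_self
  have hle : 𝓝[<] (1 : ℝ) ≤ 𝓝[Ico 0 1] 1 := by
    rw [nhdsWithin_Ico_eq_nhdsLT zero_lt_one]
  refine ((tendsto_velocity_backwardFlow_one hp hscore h hz hx₀ hindep hpint x₁).mono_left
    hle).congr' ?_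
  filter_upwards [hmem] with s hs
  exact (hasDerivAt_backwardFlow hp hscore h hz hx₀ hindep x₁ hs).deriv.symm

lemma contDiffOn_backwardFlow_Icc (x₁ : ℝ) :
    ContDiffOn ℝ 1 (backwardFlow p₀ α γ x₁) (Icc 0 1) := by
  set v : ℝ → ℝ := fun t => velocity p₀ α γ (backwardFlow p₀ α γ x₁ t) t
  set e := timeDeriv α 1 * x₁ + timeDeriv γ 1 * ∫ x, x * p₀ x
  -- At `t = 1` division by zero makes `v` equal to `α'(1) x₁`, losing the mean term, so its value
  -- there is replaced by the true limit `e`.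
  have hne : ∀ t ∈ Ico (0 : ℝ) 1, Function.update v 1 e t = v t := fun t ht =>
    Function.update_of_ne ht.2.ne _ _
  refine contDiffOn_one_of_hasDerivWithinAt (f' := Function.update v 1 e)
    (uniqueDiffOn_Icc zero_lt_one) (fun t ht => ?_) ?_
  · rcases ht.2.eq_or_lt with rfl | h1
    · rw [Function.update_self]
      exact hasDerivWithinAt_backwardFlow_one hp hscore h hz hx₀ hindep hpint x₁
    · rw [hne t ⟨ht.1, h1⟩]
      exact hasDerivWithinAt_backwardFlow hp hscore h hz hx₀ hindep x₁ ⟨ht.1, h1⟩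
  · rw [continuousOn_update_iff, Icc_sdiff_right]
    exact ⟨continuousOn_velocity_backwardFlow hp hscore h hz hx₀ hindep x₁, fun _ =>
      tendsto_velocity_backwardFlow_one hp hscore h hz hx₀ hindep hpint x₁⟩

end

/-! ### Monotone transport -/

lemma map_eq_densityMeasure_of_cdf_eq {p q : ℝ → ℝ} (hp : IsPositiveDensity p)
    (hq : IsPositiveDensity q) {g : ℝ → ℝ}
    (hg : ∀ x, (∫ u in Iic (g x), q u) = ∫ u in Iic x, p u) :
    (densityMeasure p).map g = densityMeasure q := by
  have := hp.isProbabilityMeasure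
  have hmono : Monotone g := fun x y hxy => by
    rw [← hq.strictMono_cdf.le_iff_le]
    simpa only [hg] using hp.strictMono_cdf.monotone hxy
  have := Measure.isProbabilityMeasure_map (μ := densityMeasure p) hmono.measurable.aemeasurable
  refine Measure.ext_of_Iic _ _ fun a => ?_
  -- With `b` the point where the source distribution function equals the target one at `a`, the
  -- preimage of `Iic a` is exactly `Iic b`.
  obtain ⟨b, hb⟩ := hp.exists_cdf_eq (hq.cdf_mem_Ioo a)
  have hpre : g ⁻¹' Iic a = Iic b := by
    ext x
    rw [mem_preimage, mem_Iic, mem_Iic, ← hq.strictMono_cdf.le_iff_le (a := g x),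
      ← hp.strictMono_cdf.le_iff_le (a := x)]
    simp only [hg, hb]
  rw [Measure.map_apply hmono.measurable measurableSet_Iic, hpre,
    hp.densityMeasure_apply measurableSet_Iic, hq.densityMeasure_apply measurableSet_Iic, hb]

/-- Monotonicity places `Iic x` between the preimages of `Iio (g x)` and `Iic (g x)`, which have
equal mass since the target has no atoms. The identity thus holds at every `x`, not just almost
everywhere. -/
lemma cdf_eq_of_monotone_of_map_eq {p q : ℝ → ℝ} (hp : IsPositiveDensity p)
    (hq : IsPositiveDensity q) {g : ℝ → ℝ} (hmono : Monotone g)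
    (hmap : (densityMeasure p).map g = densityMeasure q) (x : ℝ) :
    (∫ u in Iic (g x), q u) = ∫ u in Iic x, p u := by
  have := hp.isProbabilityMeasure
  refine le_antisymm ?_ ?_
  · have hsub : g ⁻¹' Iio (g x) ⊆ Iic x := fun y hy =>
      le_of_lt (lt_of_not_ge fun hxy => (hmono hxy).not_gt hy)
    have hae : (densityMeasure q).real (Iic (g x)) = (densityMeasure q).real (Iio (g x)) :=
      measureReal_congr (Iio_ae_eq_Iic'
        (IsPositiveDensity.densityMeasure_singleton q (g x))).symm
    rw [← hp.densityMeasure_real_Iic, ← hq.densityMeasure_real_Iic, hae, ← hmap,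
      map_measureReal_apply hmono.measurable measurableSet_Iio]
    exact measureReal_mono hsub
  · have hsub : Iic x ⊆ g ⁻¹' Iic (g x) := fun y hy => hmono hy
    rw [← hp.densityMeasure_real_Iic, ← hq.densityMeasure_real_Iic, ← hmap,
      map_measureReal_apply hmono.measurable measurableSet_Iic]
    exact measureReal_mono hsub

lemma marginalDensity_zero (h : IsSchedule α γ) :
    marginalDensity p₀ α γ 0 = p₀ := by
  ext x
  rw [marginalDensity_eq (h.γ_pos (left_mem_Ico.2 zero_lt_one)), h.α_zero, h.γ_zero]
  simp

end ProbabilityFlow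

theorem mainTheorem4 {Ω : Type*} [MeasurableSpace Ω] (P : Measure Ω) [IsProbabilityMeasure P]
    (p₀ : ℝ → ℝ) (hp₀ : ProbabilityFlow.IsPositiveDensity p₀)
    (A B : ℝ) (hscore : ∀ x, |ProbabilityFlow.score p₀ x| ≤ A + B * |x|)
    (z x₀ : Ω → ℝ) (hz : HasLaw z (gaussianReal 0 1) P)
    (hx₀ : HasLaw x₀ (ProbabilityFlow.densityMeasure p₀) P) (hindep : IndepFun z x₀ P)
    (α γ : ℝ → ℝ) (hαγ : ProbabilityFlow.IsSchedule α γ) :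
    -- `p_t` is a positive differentiable density of `x_t`, for every `t ∈ [0,1]`
    (∀ t ∈ Icc (0 : ℝ) 1,
      ProbabilityFlow.IsPositiveDensity (ProbabilityFlow.marginalDensity p₀ α γ t) ∧
      HasLaw (ProbabilityFlow.forwardProcess α γ z x₀ t)
        (ProbabilityFlow.densityMeasure (ProbabilityFlow.marginalDensity p₀ α γ t)) P) ∧
    -- `x_0 ∼ p₀` and `x_1 ∼ N(0,1)`
    HasLaw (ProbabilityFlow.forwardProcess α γ z x₀ 0) (ProbabilityFlow.densityMeasure p₀) P ∧
    HasLaw (ProbabilityFlow.forwardProcess α γ z x₀ 1) (gaussianReal 0 1) P ∧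
    -- `F_0` is an increasing bijection of `ℝ` onto `(0,1)`, and `F_1` has values in `(0,1)`
    StrictMono (ProbabilityFlow.marginalCDF p₀ α γ 0) ∧
    BijOn (ProbabilityFlow.marginalCDF p₀ α γ 0) univ (Ioo 0 1) ∧
    (∀ x, ProbabilityFlow.marginalCDF p₀ α γ 1 x ∈ Ioo (0 : ℝ) 1) ∧
    -- the flow `X x₁ t = x_t(x₁)` of the backward ODE
    ∃ X : ℝ → ℝ → ℝ,
      (∀ x₁, ProbabilityFlow.IsBackwardSolution p₀ α γ x₁ (X x₁) ∧
        (∀ y, ProbabilityFlow.IsBackwardSolution p₀ α γ x₁ y → EqOn y (X x₁) (Icc 0 1)) ∧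
        ContDiffOn ℝ 1 (X x₁) (Ico 0 1) ∧
        (Integrable (fun x => x * p₀ x) →
          ContDiffOn ℝ 1 (X x₁) (Icc 0 1) ∧
          HasDerivWithinAt (X x₁)
            (ProbabilityFlow.timeDeriv α 1 * x₁
              + ProbabilityFlow.timeDeriv γ 1 * ∫ x, x * p₀ x) (Icc 0 1) 1)) ∧
      (∀ x₁, X x₁ 0 = Function.invFun (ProbabilityFlow.marginalCDF p₀ α γ 0)
        (ProbabilityFlow.marginalCDF p₀ α γ 1 x₁)) ∧
      StrictMono (fun x₁ => X x₁ 0) ∧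
      (gaussianReal 0 1).map (fun x₁ => X x₁ 0) = ProbabilityFlow.densityMeasure p₀ ∧
      (∀ h : ℝ → ℝ, Monotone h →
        (gaussianReal 0 1).map h = ProbabilityFlow.densityMeasure p₀ →
        h = fun x₁ => X x₁ 0) := by
  have h0 : (0 : ℝ) ∈ Icc (0 : ℝ) 1 := left_mem_Icc.2 zero_le_one
  have h1 : (1 : ℝ) ∈ Icc (0 : ℝ) 1 := right_mem_Icc.2 zero_le_one
  have hφ := ProbabilityFlow.isPositiveDensity_gaussianPDFReal
  have hmono := ProbabilityFlow.strictMono_marginalCDF hp₀ hscore hαγ h0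
  have hF₀ : ∀ x, ProbabilityFlow.marginalCDF p₀ α γ 0 x = ∫ u in Iic x, p₀ u := fun x => by
    rw [ProbabilityFlow.marginalCDF, ProbabilityFlow.marginalDensity_zero hαγ]
  have hF₁ : ∀ x, ProbabilityFlow.marginalCDF p₀ α γ 1 x
      = ∫ u in Iic x, gaussianPDFReal 0 1 u := fun x => by
    rw [ProbabilityFlow.marginalCDF, ProbabilityFlow.marginalDensity_one hαγ]
  have hflow : ∀ x, (∫ u in Iic (ProbabilityFlow.backwardFlow p₀ α γ x 0), p₀ u)
      = ∫ u in Iic x, gaussianPDFReal 0 1 u := fun x => by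
    rw [← hF₀, ← hF₁, ProbabilityFlow.marginalCDF_backwardFlow hp₀ hscore hαγ x h0]
  refine ⟨fun t ht => ⟨ProbabilityFlow.isPositiveDensity_marginalDensity hp₀ hscore hαγ ht,
      ProbabilityFlow.hasLaw_forwardProcess hp₀ hscore hz hx₀ hindep hαγ ht⟩,
    ProbabilityFlow.hasLaw_forwardProcess_zero hx₀ hαγ,
    ProbabilityFlow.hasLaw_forwardProcess_one hz hαγ, hmono,
    ProbabilityFlow.bijOn_marginalCDF hp₀ hscore hαγ h0,
    ProbabilityFlow.marginalCDF_mem_Ioo hp₀ hscore hαγ h1,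
    ProbabilityFlow.backwardFlow p₀ α γ, fun x₁ => ⟨?_, ?_, ?_, fun hpint => ⟨?_, ?_⟩⟩,
    fun _ => rfl, ProbabilityFlow.strictMono_backwardFlow hp₀ hscore hαγ h0, ?_,
    fun g hg hmap => funext fun x => ?_⟩
  · exact ProbabilityFlow.isBackwardSolution_backwardFlow hp₀ hscore hαγ hz hx₀ hindep x₁
  · exact fun y hy => ProbabilityFlow.eqOn_backwardFlow hp₀ hscore hαγ hz hx₀ hindep hy
  · exact ProbabilityFlow.contDiffOn_backwardFlow_Ico hp₀ hscore hαγ hz hx₀ hindep x₁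
  · exact ProbabilityFlow.contDiffOn_backwardFlow_Icc hp₀ hscore hαγ hz hx₀ hindep hpint x₁
  · exact ProbabilityFlow.hasDerivWithinAt_backwardFlow_one hp₀ hscore hαγ hz hx₀ hindep hpint x₁
  · rw [← ProbabilityFlow.densityMeasure_gaussianPDFReal]
    exact ProbabilityFlow.map_eq_densityMeasure_of_cdf_eq hφ hp₀ hflow
  · rw [← ProbabilityFlow.densityMeasure_gaussianPDFReal] at hmap
    refine hmono.injective ?_
    rw [hF₀, hF₀, hflow, ProbabilityFlow.cdf_eq_of_monotone_of_map_eq hφ hp₀ hg hmap x]
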